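/- Let $(\Omega,\mathcal F,\mathbb P)$ be a complete probability space with a measurable $\mathbb P$-preserving transformation $\vartheta:\Omega\to\Omega$, and let $X$ be a compact metric space with Borel $\sigma$-algebra $\mathcal B$. Let $\mathcal E\in\mathcal F\otimes\mathcal B$ be a subset of $\Omega\times X$ all of whose fibers $\mathcal E_\omega=\{x\in X:(\omega,x)\in\mathcal E\}$ are nonempty and compact. Let $T$ be a continuous bundle random dynamical system on $\mathcal E$, i.e. a family of maps $T_\omega:\mathcal E_\omega\to\mathcal E_{\vartheta\omega}$, $\omega\in\Omega$, such that $(\omega,x)\mapsto T_\omega x$ is measurable on $\mathcal E$ and $T_\omega$ is continuous for $\mathbb P$-almost every $\omega$. Put $T^0_\omega=\mathrm{id}$, $T^n_\omega=T_{\vartheta^{n-1}\omega}\circ\cdots\circ T_{\vartheta\omega}\circ T_\omega$ for $n\ge1$, and $\Theta(\omega,x)=(\vartheta\omega,T_\omega x)$ for $(\omega,x)\in\mathcal E$. Let $\mathcal I_{\mathbb P}(\mathcal E)$ be the set of probability measures $\mu$ on $\Omega\times X$ with marginal $\mathbb P$ on $\Omega$ and $\mu(\mathcal E)=1$ that are $\Theta$-invariant.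 **Proposition.** Let $E\subset X$ be closed. Then the $\omega$-orbit capacity $$\mathrm{ocap}^\omega(E)=\lim_{n\to\infty}\frac1n\sup_{x\in\mathcal E_\omega}\sum_{i=0}^{n-1}1_E(T^i_\omega x)$$ exists for $\mathbb P$-almost every $\omega$, it is $\mathbb P$-integrable as a function of $\omega$, the set $\mathcal I_{\mathbb P}(\mathcal E)$ is nonempty, and $$\int_\Omega \mathrm{ocap}^\omega(E)\,d\mathbb P(\omega)=\sup\{\mu(\Omega\times E):\mu\in\mathcal I_{\mathbb P}(\mathcal E)\}.$$ -/

import Mathlib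

open MeasureTheory Filter Topology

noncomputable section

/-- A continuous bundle random dynamical system over `(Ω, P, ϑ)` with fibers in `X`: a measurable
set `carrier ⊆ Ω × X` with nonempty compact fibers, and fiber maps `T ω` from the fiber over `ω` to
the fiber over `ϑ ω`, jointly measurable in `(ω, x)` and continuous in `x` for almost every `ω`. -/
structure BundleRDS {Ω : Type*} [MeasurableSpace Ω] (P : Measure Ω) (ϑ : Ω → Ω)
    (X : Type*) [TopologicalSpace X] [MeasurableSpace X] where
  carrier : Set (Ω × X)
  measurableSet_carrier : MeasurableSet carrier
  nonempty_fiber : ∀ ω, {x : X | (ω, x) ∈ carrier}.Nonempty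
  isCompact_fiber : ∀ ω, IsCompact {x : X | (ω, x) ∈ carrier}
  T : ∀ ω, {x : X | (ω, x) ∈ carrier} → {x : X | (ϑ ω, x) ∈ carrier}
  measurable_T : Measurable (fun p : carrier => (T p.1.1 ⟨p.1.2, p.2⟩ : X))
  continuous_T : ∀ᵐ ω ∂P, Continuous (T ω)

namespace BundleRDS

variable {Ω : Type*} [MeasurableSpace Ω] {P : Measure Ω} {ϑ : Ω → Ω}
  {X : Type*} [TopologicalSpace X] [MeasurableSpace X]

/-- The fiber of the bundle over `ω`. -/
def fiber (R : BundleRDS P ϑ X) (ω : Ω) : Set X := {x : X | (ω, x) ∈ R.carrier}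

/-- The skew product transformation `Θ (ω, x) = (ϑ ω, T_ω x)` of the bundle. -/
def skew (R : BundleRDS P ϑ X) (p : R.carrier) : R.carrier :=
  ⟨(ϑ p.1.1, (R.T p.1.1 ⟨p.1.2, p.2⟩ : X)), (R.T p.1.1 ⟨p.1.2, p.2⟩).2⟩

/-- The iterate `T_ω^n = T_{ϑ^{n-1} ω} ∘ ⋯ ∘ T_{ϑ ω} ∘ T_ω`, with `T_ω^0 = id`. -/
def iter (R : BundleRDS P ϑ X) : (n : ℕ) → (ω : Ω) → R.fiber ω → R.fiber (ϑ^[n] ω)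
  | 0, _, x => x
  | n + 1, ω, x => iter R n (ϑ ω) (R.T ω x)

/-- `(1 / n) * sup_{x ∈ fiber ω} ∑_{i < n} 1_E (T_ω^i x)`. -/
def orbitFreq (R : BundleRDS P ϑ X) (E : Set X) (n : ℕ) (ω : Ω) : ℝ :=
  (1 / (n : ℝ)) * ⨆ x : R.fiber ω,
    ∑ i ∈ Finset.range n, E.indicator (fun _ => (1 : ℝ)) (R.iter i ω x : X)

/-- The `ω`-orbit capacity of `E`: the limit of `orbitFreq` as `n → ∞`. -/
def ocap (R : BundleRDS P ϑ X) (E : Set X) (ω : Ω) : ℝ :=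
  limUnder atTop (fun n : ℕ => R.orbitFreq E n ω)

/-- The probability measures on `Ω × X` with marginal `P` on `Ω` that give full mass to the bundle
and whose restriction to the bundle is invariant under the skew product. -/
def invariantMeasures (R : BundleRDS P ϑ X) : Set (Measure (Ω × X)) :=
  {μ | IsProbabilityMeasure μ ∧ μ.map Prod.fst = P ∧ μ R.carrier = 1 ∧
    MeasurePreserving R.skew (μ.comap (Subtype.val : R.carrier → Ω × X))
      (μ.comap (Subtype.val : R.carrier → Ω × X))}

end BundleRDS

end

/-!
The numbers `∑_{i < n} 1_E (T_ω^i x)`, maximized over `x` in the fiber, form a bounded subadditive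
process over `ϑ`, measurable because projections of measurable sets are measurable in a complete
probability space. The subadditive ergodic theorem gives the orbit capacity and the convergence of
the normalized integrals to its integral. An invariant measure has mass at most that integral on
`Ω × E`, since `n μ(Ω × E)` is the integral of the Birkhoff sum. Conversely, averaging along orbits
the law of a measurable maximizer of the `n`-th Birkhoff sum yields a measure that is invariant up
to an error of order `1 / n` and has nearly the required mass.

To pass to the limit over a base without topology, the measures are disintegrated over `P`, and the
disintegrations are encoded as elements of an `L²` space by integrating countably many test
functions. Nearly optimal measures form decreasing, midpoint-convex, bounded sets there, so the
parallelogram identity makes points of almost minimal norm a Cauchy sequence. Along a subsequence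
the fiber measures then converge weakly for almost every `ω`, and the limit is invariant and
optimal.
-/

noncomputable section

section MeasurableProjection

lemma exists_forall_lt_le_subset_of_isOpen {M : ℕ → ℕ} {V : Set (ℕ → ℕ)} (hV : IsOpen V)
    (hMV : Set.Iic M ⊆ V) : ∃ n, {x : ℕ → ℕ | ∀ i < n, x i ≤ M i} ⊆ V := by
  have isCompact_box : IsCompact (Set.Iic M) := by
    rw [← Set.Icc_bot]
    exact isCompact_Icc
  have isOpen_core (n : ℕ) : IsOpen {x | PiNat.cylinder x n ⊆ V} := by
    refine isOpen_iff_mem_nhds.2 fun x hx => ?_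
    filter_upwards [(PiNat.isOpen_cylinder _ x n).mem_nhds (PiNat.self_mem_cylinder x n)]
      with y hy
    rwa [PiNat.mem_cylinder_iff_eq.1 hy]
  have box_subset_iUnion_core : Set.Iic M ⊆ ⋃ n, {x | PiNat.cylinder x n ⊆ V} := by
    intro x hx
    obtain ⟨_, ⟨z, n, rfl⟩, hxz, hzV⟩ :=
      (PiNat.isTopologicalBasis_cylinders fun _ : ℕ => ℕ).exists_subset_of_mem_open (hMV hx) hV
    refine Set.mem_iUnion.2 ⟨n, ?_⟩
    rwa [Set.mem_ofPred_eq, PiNat.mem_cylinder_iff_eq.1 hxz]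
  obtain ⟨n, hn⟩ := isCompact_box.elim_directed_cover _ isOpen_core box_subset_iUnion_core
    (Monotone.directed_le fun m n hmn x hx => (PiNat.cylinder_anti x hmn).trans hx)
  refine ⟨n, fun y hy => hn (Set.mem_Iic.2 (inf_le_right : y ⊓ M ≤ M)) fun i hi => ?_⟩
  exact (min_eq_left (hy i hi)).symm

variable {Y : Type*} [MeasurableSpace Y]

lemma exists_lt_measure_image_inter_le (μ : Measure Y) (g : (ℕ → ℕ) → Y) {c : ENNReal}
    (k : ℕ) {D : Set (ℕ → ℕ)} (hD : c < μ (g '' D)) :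
    ∃ m, c < μ (g '' (D ∩ {x | x k ≤ m})) := by
  have monotone_image : Monotone fun m : ℕ => g '' (D ∩ {x | x k ≤ m}) := fun a b hab =>
    Set.image_mono (Set.inter_subset_inter_right _ fun x hx => le_trans hx hab)
  have iUnion_image : ⋃ m : ℕ, g '' (D ∩ {x | x k ≤ m}) = g '' D := by
    rw [← Set.image_iUnion, ← Set.inter_iUnion,
      Set.inter_eq_left.2 fun x _ => Set.mem_iUnion.2 ⟨x k, le_refl (x k)⟩]
  rwa [← iUnion_image, monotone_image.measure_iUnion, lt_iSup_iff] at hD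

lemma exists_forall_lt_measure_image (μ : Measure Y) (g : (ℕ → ℕ) → Y) {c : ENNReal}
    (hc : c < μ (Set.range g)) :
    ∃ M : ℕ → ℕ, ∀ n, c < μ (g '' {x | ∀ i < n, x i ≤ M i}) := by
  choose! m hm using fun k D => exists_lt_measure_image_inter_le μ g (c := c) k (D := D)
  let D : ℕ → Set (ℕ → ℕ) := fun n => Nat.rec Set.univ (fun k D => D ∩ {x | x k ≤ m k D}) n
  refine ⟨fun i => m i (D i), fun n => ?_⟩
  have lt_measure_image (n : ℕ) : c < μ (g '' D n) := by
    induction n with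
    | zero => rwa [← Set.image_univ] at hc
    | succ n ih => exact hm n _ ih
  have D_eq (n : ℕ) : D n = {x | ∀ i < n, x i ≤ m i (D i)} := by
    induction n with
    | zero => simp [D]
    | succ n ih =>
      ext x
      rw [show D (n + 1) = D n ∩ {x | x n ≤ m n (D n)} from rfl, Set.mem_inter_iff]
      nth_rw 1 [ih]
      exact Nat.forall_lt_succ_right.symm
  exact D_eq n ▸ lt_measure_image n

lemma exists_isCompact_subset_range_le_measure [TopologicalSpace Y] (μ : Measure Y)
    [μ.OuterRegular] {g : (ℕ → ℕ) → Y} (hg : Continuous g) {c : ENNReal}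
    (hc : c < μ (Set.range g)) : ∃ K ⊆ Set.range g, IsCompact K ∧ c ≤ μ K := by
  obtain ⟨M, hM⟩ := exists_forall_lt_measure_image μ g hc
  refine ⟨g '' Set.Iic M, Set.image_subset_range _ _, ?_, ?_⟩
  · rw [← Set.Icc_bot]
    exact isCompact_Icc.image hg
  · rw [Set.measure_eq_iInf_isOpen]
    refine le_iInf₂ fun U hU => le_iInf fun hUo => ?_
    obtain ⟨n, hn⟩ :=
      exists_forall_lt_le_subset_of_isOpen (hUo.preimage hg) (Set.image_subset_iff.1 hU)
    exact (hM n).le.trans (measure_mono (Set.image_subset_iff.2 hn))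

lemma nullMeasurableSet_of_analyticSet [TopologicalSpace Y] [T2Space Y] [OpensMeasurableSpace Y]
    (μ : Measure Y) [μ.OuterRegular] [IsFiniteMeasure μ] {S : Set Y} (hS : AnalyticSet S) :
    NullMeasurableSet S μ := by
  rw [AnalyticSet] at hS
  rcases hS with rfl | ⟨g, hg, rfl⟩
  · exact nullMeasurableSet_empty
  by_cases h0 : μ (Set.range g) = 0
  · exact NullMeasurableSet.of_null h0
  obtain ⟨u, -, hu, u_tendsto⟩ := exists_seq_strictMono_tendsto' (pos_iff_ne_zero.2 h0)
  choose K K_subset isCompact_K le_measure_K using fun n =>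
    exists_isCompact_subset_range_le_measure μ hg (hu n).2
  have measurableSet_iUnion_K : MeasurableSet (⋃ n, K n) :=
    MeasurableSet.iUnion fun n => (isCompact_K n).measurableSet
  have measure_range_le : μ (Set.range g) ≤ μ (⋃ n, K n) :=
    le_of_tendsto' u_tendsto fun n =>
      (le_measure_K n).trans (measure_mono (Set.subset_iUnion K n))
  exact measurableSet_iUnion_K.nullMeasurableSet.congr
    (ae_eq_of_subset_of_measure_ge (Set.iUnion_subset K_subset) measure_range_le
      measurableSet_iUnion_K.nullMeasurableSet (measure_ne_top _ _))

variable {Ω X : Type*} [MeasurableSpace Ω] [MeasurableSpace X]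

/- Only countably many measurable rectangles generate `A`, and a point of the Cantor space records
which of their bases contain `ω`. -/
lemma exists_measurable_cantor_preimage {A : Set (Ω × X)} (hA : MeasurableSet A) :
    ∃ (f : Ω → ℕ → Bool) (A' : Set ((ℕ → Bool) × X)), Measurable f ∧ MeasurableSet A' ∧
      A = Prod.map f id ⁻¹' A' := by
  classical
  induction A, hA using MeasurableSpace.induction_on_inter generateFrom_prod.symm
    isPiSystem_prod with
  | empty => exact ⟨fun _ _ => true, ∅, measurable_const, MeasurableSet.empty, rfl⟩
  | basic t ht =>
    obtain ⟨s, hs, u, hu, rfl⟩ := ht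
    refine ⟨fun ω _ => decide (ω ∈ s), {y | y 0 = true} ×ˢ u, ?_, ?_, ?_⟩
    · exact measurable_pi_lambda _ fun _ => measurable_to_bool (by simpa [Set.preimage] using hs)
    · exact (measurableSet_eq_fun (measurable_pi_apply 0) measurable_const).prod hu
    · ext p
      simp
  | compl t _ ih =>
    obtain ⟨f, A', hf, hA', rfl⟩ := ih
    exact ⟨f, A'ᶜ, hf, hA'.compl, rfl⟩
  | iUnion t _ _ ih =>
    choose f A' hf hA' ht using ih
    have measurable_slice (n : ℕ) : Measurable fun (y : ℕ → Bool) k => y (Nat.pair n k) :=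
      measurable_pi_lambda _ fun k => measurable_pi_apply _
    refine ⟨fun ω k => f k.unpair.1 ω k.unpair.2,
      ⋃ n, Prod.map (fun y k => y (Nat.pair n k)) id ⁻¹' A' n, ?_, ?_, ?_⟩
    · exact measurable_pi_lambda _ fun k => (measurable_pi_apply _).comp (hf _)
    · exact MeasurableSet.iUnion fun n =>
        (hA' n).preimage ((measurable_slice n).prodMap measurable_id)
    · rw [Set.preimage_iUnion]
      refine Set.iUnion_congr fun n => (ht n).trans ?_
      ext p
      simp [Prod.map]

lemma measurableSet_image_fst (P : Measure Ω) [IsFiniteMeasure P] [P.IsComplete]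
    [StandardBorelSpace X] {A : Set (Ω × X)} (hA : MeasurableSet A) :
    MeasurableSet (Prod.fst '' A) := by
  let := upgradeStandardBorel X
  let := TopologicalSpace.metrizableSpaceMetric (ℕ → Bool)
  obtain ⟨f, A', hf, hA', rfl⟩ := exists_measurable_cantor_preimage hA
  have analyticSet_image : AnalyticSet (Prod.fst '' A') :=
    hA'.analyticSet.image_of_continuous continuous_fst
  have image_eq_preimage : Prod.fst '' (Prod.map f id ⁻¹' A') = f ⁻¹' (Prod.fst '' A') := by
    ext ω
    simp
  rw [image_eq_preimage]
  exact ((nullMeasurableSet_of_analyticSet (P.map f) analyticSet_image).preimage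
    (hf.quasiMeasurePreserving P)).measurable_of_complete

end MeasurableProjection

section MeasurableSelection

variable {Ω X : Type*}

/-- The fiberwise supremum `ω ↦ sup {f (ω, x) : (ω, x) ∈ A}`, meaningful when `f` is bounded above
on the nonempty fibers of `A`. -/
def fiberSup (A : Set (Ω × X)) (f : Ω × X → ℝ) (ω : Ω) : ℝ :=
  ⨆ x : Prod.mk ω ⁻¹' A, f (ω, x)

/-- The points of `A` at which `f` is maximal along its fiber of `A`. -/
def fiberArgmax (A : Set (Ω × X)) (f : Ω × X → ℝ) : Set (Ω × X) :=
  {p ∈ A | fiberSup A f p.1 ≤ f p}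

lemma fiberArgmax_subset (A : Set (Ω × X)) (f : Ω × X → ℝ) : fiberArgmax A f ⊆ A :=
  Set.sep_subset _ _

lemma le_fiberSup {A : Set (Ω × X)} {f : Ω × X → ℝ} {ω : Ω} {x : X}
    (hf : BddAbove ((fun x => f (ω, x)) '' (Prod.mk ω ⁻¹' A))) (hx : (ω, x) ∈ A) :
    f (ω, x) ≤ fiberSup A f ω :=
  le_ciSup_set hf hx

lemma fiberSup_eq_of_mem_fiberArgmax {A : Set (Ω × X)} {f : Ω × X → ℝ} {p : Ω × X}
    (hf : BddAbove ((fun x => f (p.1, x)) '' (Prod.mk p.1 ⁻¹' A))) (hp : p ∈ fiberArgmax A f) :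
    f p = fiberSup A f p.1 :=
  (le_fiberSup hf hp.1).antisymm hp.2

variable [MeasurableSpace Ω] [MeasurableSpace X]

lemma measurable_fiberSup (P : Measure Ω) [IsFiniteMeasure P] [P.IsComplete] [StandardBorelSpace X]
    {A : Set (Ω × X)} (hA : MeasurableSet A) (hne : ∀ ω, (Prod.mk ω ⁻¹' A).Nonempty)
    {f : Ω × X → ℝ} (hf : Measurable f)
    (hbdd : ∀ ω, BddAbove ((fun x => f (ω, x)) '' (Prod.mk ω ⁻¹' A))) :
    Measurable (fiberSup A f) := by
  refine measurable_of_Ioi fun c => ?_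
  have preimage_eq_image : fiberSup A f ⁻¹' Set.Ioi c = Prod.fst '' (A ∩ f ⁻¹' Set.Ioi c) := by
    ext ω
    have := (hne ω).to_subtype
    simp [fiberSup, lt_ciSup_iff (Set.image_eq_range _ _ ▸ hbdd ω)]
  rw [preimage_eq_image]
  exact measurableSet_image_fst P (hA.inter (hf measurableSet_Ioi))

lemma measurable_of_graph (P : Measure Ω) [IsFiniteMeasure P] [P.IsComplete] [StandardBorelSpace X]
    {A : Set (Ω × X)} (hA : MeasurableSet A) {s : Ω → X}
    (hs : ∀ ω x, (ω, x) ∈ A ↔ x = s ω) : Measurable s := by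
  intro C hC
  have preimage_eq_image : s ⁻¹' C = Prod.fst '' (A ∩ Prod.snd ⁻¹' C) := by
    ext ω
    simp [hs]
  rw [preimage_eq_image]
  exact measurableSet_image_fst P (hA.inter (measurable_snd hC))

/-- A random nonempty compact set, encoded by its graph in `Ω × X`. -/
structure IsRandomCompact [TopologicalSpace X] (A : Set (Ω × X)) : Prop where
  measurableSet : MeasurableSet A
  nonempty_fiber : ∀ ω, (Prod.mk ω ⁻¹' A).Nonempty
  isCompact_fiber : ∀ ω, IsCompact (Prod.mk ω ⁻¹' A)

namespace IsRandomCompact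

variable [TopologicalSpace X] {A : Set (Ω × X)}

lemma bddAbove_image (hA : IsRandomCompact A) {f : Ω × X → ℝ} {ω : Ω}
    (husc : UpperSemicontinuousOn (fun x => f (ω, x)) (Prod.mk ω ⁻¹' A)) :
    BddAbove ((fun x => f (ω, x)) '' (Prod.mk ω ⁻¹' A)) :=
  husc.bddAbove_of_isCompact (hA.isCompact_fiber ω)

lemma isClosed_fiber [T2Space X] (hA : IsRandomCompact A) (ω : Ω) : IsClosed (Prod.mk ω ⁻¹' A) :=
  (hA.isCompact_fiber ω).isClosed

end IsRandomCompact

variable [StandardBorelSpace X]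

lemma isRandomCompact_fiberArgmax [TopologicalSpace X] (P : Measure Ω) [IsFiniteMeasure P]
    [P.IsComplete] {A : Set (Ω × X)} (hA : IsRandomCompact A) {f : Ω × X → ℝ} (hf : Measurable f)
    (husc : ∀ ω, UpperSemicontinuousOn (fun x => f (ω, x)) (Prod.mk ω ⁻¹' A)) :
    IsRandomCompact (fiberArgmax A f) where
  measurableSet := hA.measurableSet.inter <| measurableSet_le
    ((measurable_fiberSup P hA.measurableSet hA.nonempty_fiber hf
      fun ω => hA.bddAbove_image (husc ω)).comp measurable_fst) hf
  nonempty_fiber ω := by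
    obtain ⟨x, hx, hmax⟩ := (husc ω).exists_isMaxOn (hA.nonempty_fiber ω) (hA.isCompact_fiber ω)
    exact ⟨x, hx, (hmax.iSup_eq hx).le⟩
  isCompact_fiber ω :=
    (husc ω).isCompact_inter_preimage_Ici (hA.isCompact_fiber ω) (fiberSup A f ω)

section Selection

variable [MetricSpace X] [SecondCountableTopology X] [OpensMeasurableSpace X]

/-- The successive sets `A ⊇ A₁ ⊇ A₂ ⊇ ⋯`, where `Aₙ₊₁` consists of the points of `Aₙ` farthest
from the `n`-th point of a dense sequence. Their fibers shrink to single points, which makes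
`⋂ n, Aₙ` the graph of a selection. -/
def shrinkingSeq [Nonempty X] (A : Set (Ω × X)) : ℕ → Set (Ω × X)
  | 0 => A
  | n + 1 => fiberArgmax (shrinkingSeq A n) fun p => dist p.2 (TopologicalSpace.denseSeq X n)

lemma isRandomCompact_shrinkingSeq [Nonempty X] (P : Measure Ω) [IsFiniteMeasure P] [P.IsComplete]
    {A : Set (Ω × X)} (hA : IsRandomCompact A) (n : ℕ) : IsRandomCompact (shrinkingSeq A n) := by
  induction n with
  | zero => exact hA
  | succ n ih =>
    exact isRandomCompact_fiberArgmax P ih (measurable_snd.dist measurable_const) fun ω =>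
      (continuous_id.dist continuous_const).upperSemicontinuous.upperSemicontinuousOn _

lemma eq_of_forall_mem_shrinkingSeq [Nonempty X] (P : Measure Ω) [IsFiniteMeasure P]
    [P.IsComplete] {A : Set (Ω × X)} (hA : IsRandomCompact A) {ω : Ω} {x y : X}
    (hx : ∀ n, (ω, x) ∈ shrinkingSeq A n) (hy : ∀ n, (ω, y) ∈ shrinkingSeq A n) : x = y := by
  have dist_denseSeq_eq (n : ℕ) :
      dist x (TopologicalSpace.denseSeq X n) = dist y (TopologicalSpace.denseSeq X n) := by
    have hbdd : BddAbove ((fun z => dist z (TopologicalSpace.denseSeq X n)) ''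
        (Prod.mk ω ⁻¹' shrinkingSeq A n)) :=
      ((isRandomCompact_shrinkingSeq P hA n).isCompact_fiber ω).bddAbove_image
        (continuous_id.dist continuous_const).continuousOn
    exact (fiberSup_eq_of_mem_fiberArgmax hbdd (hx (n + 1))).trans
      (fiberSup_eq_of_mem_fiberArgmax hbdd (hy (n + 1))).symm
  have dist_eq : dist x = dist y :=
    (TopologicalSpace.denseRange_denseSeq X).equalizer (by fun_prop) (by fun_prop)
      (funext dist_denseSeq_eq)
  rw [← dist_eq_zero, dist_eq, dist_self]

theorem exists_measurable_selection (P : Measure Ω) [IsFiniteMeasure P] [P.IsComplete]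
    {A : Set (Ω × X)} (hA : IsRandomCompact A) :
    ∃ s : Ω → X, Measurable s ∧ ∀ ω, (ω, s ω) ∈ A := by
  rcases isEmpty_or_nonempty Ω with hΩ | ⟨⟨ω₀⟩⟩
  · exact ⟨hΩ.elim, measurable_of_empty _, hΩ.elim⟩
  have : Nonempty X := ⟨(hA.nonempty_fiber ω₀).some⟩
  have hB := isRandomCompact_shrinkingSeq P hA
  have nonempty_iInter (ω : Ω) : (⋂ n, Prod.mk ω ⁻¹' shrinkingSeq A n).Nonempty :=
    IsCompact.nonempty_iInter_of_sequence_nonempty_isCompact_isClosed _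
      (fun n => Set.preimage_mono (fiberArgmax_subset _ _)) (fun n => (hB n).nonempty_fiber ω)
      ((hB 0).isCompact_fiber ω) fun n => (hB n).isClosed_fiber ω
  choose s hs using nonempty_iInter
  simp only [Set.mem_iInter, Set.mem_preimage] at hs
  refine ⟨s, measurable_of_graph P (MeasurableSet.iInter fun n => (hB n).measurableSet)
    fun ω x => ⟨fun hx => eq_of_forall_mem_shrinkingSeq P hA (Set.mem_iInter.1 hx) (hs ω), ?_⟩,
    fun ω => hs ω 0⟩
  rintro rfl
  exact Set.mem_iInter.2 (hs ω)

theorem exists_measurable_fiberSup_eq (P : Measure Ω) [IsFiniteMeasure P] [P.IsComplete]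
    {A : Set (Ω × X)} (hA : IsRandomCompact A) {f : Ω × X → ℝ} (hf : Measurable f)
    (husc : ∀ᵐ ω ∂P, UpperSemicontinuousOn (fun x => f (ω, x)) (Prod.mk ω ⁻¹' A)) :
    ∃ s : Ω → X, Measurable s ∧ (∀ ω, (ω, s ω) ∈ A) ∧ ∀ᵐ ω ∂P, f (ω, s ω) = fiberSup A f ω := by
  obtain ⟨G, hGP, hG, husc⟩ := husc.exists_measurable_mem
  let f' : Ω × X → ℝ := (Prod.fst ⁻¹' G).indicator f
  have f'_eq {ω : Ω} (hω : ω ∈ G) (x : X) : f' (ω, x) = f (ω, x) :=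
    Set.indicator_of_mem (s := Prod.fst ⁻¹' G) hω f
  have husc' (ω : Ω) : UpperSemicontinuousOn (fun x => f' (ω, x)) (Prod.mk ω ⁻¹' A) := by
    by_cases hω : ω ∈ G
    · simpa only [f'_eq hω] using husc ω hω
    · have f'_eq_zero (x : X) : f' (ω, x) = 0 :=
        Set.indicator_of_notMem (s := Prod.fst ⁻¹' G) hω f
      simpa only [f'_eq_zero] using upperSemicontinuousOn_const
  obtain ⟨s, hs, hsA⟩ := exists_measurable_selection P
    (isRandomCompact_fiberArgmax P hA (hf.indicator (measurable_fst hG)) husc')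
  refine ⟨s, hs, fun ω => (hsA ω).1, ?_⟩
  filter_upwards [hGP] with ω hω
  calc f (ω, s ω) = f' (ω, s ω) := (f'_eq hω _).symm
    _ = fiberSup A f' ω :=
      fiberSup_eq_of_mem_fiberArgmax (hA.bddAbove_image (husc' ω)) (hsA ω)
    _ = fiberSup A f ω := by simp only [fiberSup, f'_eq hω]

end Selection

end MeasurableSelection

section SubadditiveErgodicTheorem

variable {Ω : Type*} {τ : Ω → Ω}

lemma birkhoffSum_indicator_one_nonneg (s : Set Ω) (n : ℕ) (ω : Ω) :
    0 ≤ birkhoffSum τ (s.indicator (1 : Ω → ℝ)) n ω :=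
  Finset.sum_nonneg fun _ _ => Set.indicator_nonneg (fun _ _ => zero_le_one) _

lemma abs_birkhoffSum_le {g : Ω → ℝ} {C : ℝ} (hC : ∀ ω, |g ω| ≤ C) (n : ℕ) (ω : Ω) :
    |birkhoffSum τ g n ω| ≤ n * C := by
  simpa [birkhoffSum] using (Finset.abs_sum_le_sum_abs _ _).trans
    (Finset.sum_le_card_nsmul (Finset.range n) _ C fun i _ => hC (τ^[i] ω))

/-- The lower growth rate of a process. -/
def lowerRate (a : ℕ → Ω → ℝ) (ω : Ω) : ℝ := liminf (fun n : ℕ => a n ω / n) atTop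

/-- The upper growth rate of a process. -/
def upperRate (a : ℕ → Ω → ℝ) (ω : Ω) : ℝ := limsup (fun n : ℕ => a n ω / n) atTop

/-- The points at which the averages of the process exceed its lower rate by more than `ε` at all
times up to `N`; this is the exceptional set of the covering argument for subadditive processes. -/
def highSet (a : ℕ → Ω → ℝ) (ε : ℝ) (N : ℕ) : Set Ω :=
  {ω | ∀ k ∈ Set.Icc 1 N, (k : ℝ) * (lowerRate a ω + ε) < a k ω}

variable [MeasurableSpace Ω]

lemma integral_comp_of_measurePreserving {Y G : Type*} [MeasurableSpace Y] [NormedAddCommGroup G]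
    [NormedSpace ℝ G] {μ : Measure Ω} {ν : Measure Y} {ψ : Ω → Y} (hψ : MeasurePreserving ψ μ ν)
    {φ : Y → G} (hφ : AEStronglyMeasurable φ ν) : ∫ ω, φ (ψ ω) ∂μ = ∫ y, φ y ∂ν := by
  rw [← hψ.map_eq] at hφ ⊢
  exact (integral_map hψ.aemeasurable hφ).symm

lemma measurable_birkhoffSum (hτ : Measurable τ) {g : Ω → ℝ} (hg : Measurable g) (n : ℕ) :
    Measurable (birkhoffSum τ g n) :=
  Finset.measurable_sum _ fun i _ => hg.comp (hτ.iterate i)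

lemma integrable_birkhoffSum {P : Measure Ω} (hτ : MeasurePreserving τ P P) {g : Ω → ℝ}
    (hg : Integrable g P) (n : ℕ) : Integrable (birkhoffSum τ g n) P :=
  integrable_finsetSum _ fun i _ => (hτ.iterate i).integrable_comp_of_integrable hg

lemma integral_birkhoffSum {P : Measure Ω} (hτ : MeasurePreserving τ P P) {g : Ω → ℝ}
    (hg : Integrable g P) (n : ℕ) : ∫ ω, birkhoffSum τ g n ω ∂P = n * ∫ ω, g ω ∂P := by
  calc ∫ ω, birkhoffSum τ g n ω ∂P = ∑ i ∈ Finset.range n, ∫ ω, g (τ^[i] ω) ∂P :=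
        integral_finsetSum _ fun i _ => (hτ.iterate i).integrable_comp_of_integrable hg
    _ = n * ∫ ω, g ω ∂P := by
        simp [integral_comp_of_measurePreserving (hτ.iterate _) hg.aestronglyMeasurable]

/-- A subadditive process over `τ` with `|a n| ≤ n * C`. -/
structure SubadditiveProcess (τ : Ω → Ω) (a : ℕ → Ω → ℝ) (C : ℝ) : Prop where
  measurable : ∀ n, Measurable (a n)
  abs_le_mul : ∀ n ω, |a n ω| ≤ n * C
  add_le : ∀ m n ω, a (m + n) ω ≤ a m ω + a n (τ^[m] ω)

lemma subadditiveProcess_birkhoffSum (hτ : Measurable τ) {g : Ω → ℝ} (hg : Measurable g) {C : ℝ}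
    (hC : ∀ ω, |g ω| ≤ C) : SubadditiveProcess τ (birkhoffSum τ g) C where
  measurable := measurable_birkhoffSum hτ hg
  abs_le_mul := abs_birkhoffSum_le hC
  add_le m n ω := (birkhoffSum_add τ g m n ω).le

namespace SubadditiveProcess

variable {a : ℕ → Ω → ℝ} {C : ℝ}

lemma abs_one_le (h : SubadditiveProcess τ a C) (ω : Ω) : |a 1 ω| ≤ C := by
  simpa using h.abs_le_mul 1 ω

lemma abs_div_le (h : SubadditiveProcess τ a C) (n : ℕ) (ω : Ω) : |a n ω / n| ≤ C := by
  rw [abs_div, Nat.abs_cast]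
  exact div_le_of_le_mul₀ n.cast_nonneg ((abs_nonneg _).trans (h.abs_one_le ω))
    ((h.abs_le_mul n ω).trans_eq (mul_comm _ _))

lemma isBoundedUnder_ge (h : SubadditiveProcess τ a C) (ω : Ω) :
    IsBoundedUnder (· ≥ ·) atTop fun n : ℕ => a n ω / n :=
  isBoundedUnder_of ⟨-C, fun n => (abs_le.1 (h.abs_div_le n ω)).1⟩

lemma isBoundedUnder_le (h : SubadditiveProcess τ a C) (ω : Ω) :
    IsBoundedUnder (· ≤ ·) atTop fun n : ℕ => a n ω / n :=
  isBoundedUnder_of ⟨C, fun n => (abs_le.1 (h.abs_div_le n ω)).2⟩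

lemma lowerRate_le_upperRate (h : SubadditiveProcess τ a C) (ω : Ω) :
    lowerRate a ω ≤ upperRate a ω :=
  liminf_le_limsup (h.isBoundedUnder_le ω) (h.isBoundedUnder_ge ω)

lemma le_lowerRate (h : SubadditiveProcess τ a C) {ω : Ω} {c : ℝ}
    (hc : ∀ᶠ n : ℕ in atTop, c ≤ a n ω / n) : c ≤ lowerRate a ω :=
  le_liminf_of_le (h.isBoundedUnder_le ω).isCoboundedUnder_ge hc

lemma upperRate_le (h : SubadditiveProcess τ a C) {ω : Ω} {c : ℝ}
    (hc : ∀ᶠ n : ℕ in atTop, a n ω / n ≤ c) : upperRate a ω ≤ c :=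
  limsup_le_of_le (h.isBoundedUnder_ge ω).isCoboundedUnder_le hc

lemma eventually_lt_div (h : SubadditiveProcess τ a C) {ω : Ω} {c : ℝ} (hc : c < lowerRate a ω) :
    ∀ᶠ n : ℕ in atTop, c < a n ω / n :=
  eventually_lt_of_lt_liminf hc (h.isBoundedUnder_ge ω)

lemma eventually_div_lt (h : SubadditiveProcess τ a C) {ω : Ω} {c : ℝ} (hc : upperRate a ω < c) :
    ∀ᶠ n : ℕ in atTop, a n ω / n < c :=
  eventually_lt_of_limsup_lt hc (h.isBoundedUnder_le ω)

lemma frequently_div_lt (h : SubadditiveProcess τ a C) {ω : Ω} {c : ℝ} (hc : lowerRate a ω < c) :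
    ∃ᶠ n : ℕ in atTop, a n ω / n < c :=
  frequently_lt_of_liminf_lt (h.isBoundedUnder_le ω).isCoboundedUnder_ge hc

lemma neg_le_lowerRate (h : SubadditiveProcess τ a C) (ω : Ω) : -C ≤ lowerRate a ω :=
  h.le_lowerRate (.of_forall fun n => (abs_le.1 (h.abs_div_le n ω)).1)

lemma upperRate_le_const (h : SubadditiveProcess τ a C) (ω : Ω) : upperRate a ω ≤ C :=
  h.upperRate_le (.of_forall fun n => (abs_le.1 (h.abs_div_le n ω)).2)

lemma abs_lowerRate_le (h : SubadditiveProcess τ a C) (ω : Ω) : |lowerRate a ω| ≤ C :=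
  abs_le.2 ⟨h.neg_le_lowerRate ω, (h.lowerRate_le_upperRate ω).trans (h.upperRate_le_const ω)⟩

lemma abs_upperRate_le (h : SubadditiveProcess τ a C) (ω : Ω) : |upperRate a ω| ≤ C :=
  abs_le.2 ⟨(h.neg_le_lowerRate ω).trans (h.lowerRate_le_upperRate ω), h.upperRate_le_const ω⟩

lemma measurable_lowerRate (h : SubadditiveProcess τ a C) : Measurable (lowerRate a) :=
  Measurable.liminf fun n => (h.measurable n).div_const _

lemma measurable_upperRate (h : SubadditiveProcess τ a C) : Measurable (upperRate a) :=
  Measurable.limsup fun n => (h.measurable n).div_const _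

section FiniteMeasure

variable (P : Measure Ω) [IsFiniteMeasure P]

lemma integrable (h : SubadditiveProcess τ a C) (n : ℕ) : Integrable (a n) P :=
  .of_bound (h.measurable n).aestronglyMeasurable (n * C) (.of_forall (h.abs_le_mul n))

lemma integrable_lowerRate (h : SubadditiveProcess τ a C) : Integrable (lowerRate a) P :=
  .of_bound h.measurable_lowerRate.aestronglyMeasurable C (.of_forall h.abs_lowerRate_le)

lemma integrable_upperRate (h : SubadditiveProcess τ a C) : Integrable (upperRate a) P :=
  .of_bound h.measurable_upperRate.aestronglyMeasurable C (.of_forall h.abs_upperRate_le)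

end FiniteMeasure

lemma succ_div_le (h : SubadditiveProcess τ a C) {n : ℕ} (hn : n ≠ 0) (ω : Ω) :
    a (n + 1) ω / (n + 1 : ℕ) ≤ a n (τ ω) / n + 2 * C * (1 / ((n : ℝ) + 1)) := by
  have hn' : (n : ℝ) ≠ 0 := Nat.cast_ne_zero.2 hn
  have hr := (abs_le.1 (h.abs_div_le n (τ ω))).1
  have subadd : a (n + 1) ω ≤ C + a n (τ ω) := by
    rw [add_comm n]
    exact (h.add_le 1 n ω).trans (add_le_add_left ((le_abs_self _).trans (h.abs_one_le ω)) _)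
  calc a (n + 1) ω / (n + 1 : ℕ) ≤ (C + a n (τ ω)) / (n + 1 : ℕ) := by gcongr
    _ = a n (τ ω) / n + (C - a n (τ ω) / n) * (1 / ((n : ℝ) + 1)) := by
      push_cast
      field_simp
      ring
    _ ≤ a n (τ ω) / n + 2 * C * (1 / ((n : ℝ) + 1)) := by
      gcongr
      linarith

lemma lowerRate_le_comp (h : SubadditiveProcess τ a C) (ω : Ω) :
    lowerRate a ω ≤ lowerRate a (τ ω) := by
  refine le_of_forall_pos_sub_le fun δ hδ => h.le_lowerRate ?_
  have eventually_succ : ∀ᶠ n : ℕ in atTop, lowerRate a ω - δ / 2 < a (n + 1) ω / (n + 1 : ℕ) :=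
    (tendsto_add_atTop_nat 1).eventually (h.eventually_lt_div (by linarith))
  have eventually_error : ∀ᶠ n : ℕ in atTop, 2 * C * (1 / ((n : ℝ) + 1)) < δ / 2 :=
    (tendsto_one_div_add_atTop_nhds_zero_nat.const_mul (2 * C)).eventually_lt_const
      (by simpa using half_pos hδ)
  filter_upwards [eventually_succ, eventually_error, eventually_ne_atTop 0] with n hsucc herr hn
  linarith [h.succ_div_le hn ω]

lemma ae_lowerRate_iterate {P : Measure Ω} [IsFiniteMeasure P] (h : SubadditiveProcess τ a C)
    (hτ : MeasurePreserving τ P P) : ∀ᵐ ω ∂P, ∀ i, lowerRate a (τ^[i] ω) = lowerRate a ω := by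
  have ae_eq_comp : lowerRate a =ᵐ[P] fun ω => lowerRate a (τ ω) :=
    (integral_eq_iff_of_ae_le (h.integrable_lowerRate P)
      (hτ.integrable_comp_of_integrable (h.integrable_lowerRate P))
      (.of_forall h.lowerRate_le_comp)).1
      (integral_comp_of_measurePreserving hτ h.measurable_lowerRate.aestronglyMeasurable).symm
  have ae_eq_succ : ∀ᵐ ω ∂P, ∀ i, lowerRate a (τ^[i] ω) = lowerRate a (τ (τ^[i] ω)) :=
    ae_all_iff.2 fun i => (hτ.iterate i).quasiMeasurePreserving.ae ae_eq_comp
  filter_upwards [ae_eq_succ] with ω hω i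
  induction i with
  | zero => rfl
  | succ i ih => rw [Function.iterate_succ_apply', ← hω i, ih]

lemma measurableSet_highSet (h : SubadditiveProcess τ a C) (ε : ℝ) (N : ℕ) :
    MeasurableSet (highSet a ε N) := by
  simp only [highSet, Set.ofPred_forall]
  exact MeasurableSet.biInter (Set.to_countable _) fun k _ => measurableSet_lt
    ((h.measurable_lowerRate.add_const ε).const_mul _) (h.measurable k)

section ProbabilityMeasure

variable {P : Measure Ω} [IsProbabilityMeasure P]

lemma tendsto_measureReal_highSet (h : SubadditiveProcess τ a C) {ε : ℝ} (hε : 0 < ε) :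
    Tendsto (fun N => P.real (highSet a ε N)) atTop (𝓝 0) := by
  have antitone_highSet : Antitone (highSet a ε) := fun N M hNM ω hω k hk =>
    hω k ⟨hk.1, hk.2.trans hNM⟩
  have iInter_eq_empty : ⋂ N, highSet a ε N = ∅ := by
    refine Set.eq_empty_of_forall_notMem fun ω hω => ?_
    obtain ⟨k, hk, hk1⟩ := ((h.frequently_div_lt (lt_add_of_pos_right (lowerRate a ω) hε)
      ).and_eventually (eventually_ge_atTop 1)).exists
    rw [div_lt_iff₀' (Nat.cast_pos.2 hk1)] at hk
    exact hk.not_gt (Set.mem_iInter.1 hω k k ⟨hk1, le_rfl⟩)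
  have := tendsto_measure_iInter_atTop (μ := P)
    (fun N => (h.measurableSet_highSet ε N).nullMeasurableSet) antitone_highSet
    ⟨0, measure_ne_top _ _⟩
  rw [iInter_eq_empty, measure_empty] at this
  exact (ENNReal.tendsto_toReal ENNReal.zero_ne_top).comp this

lemma const_le_lowerRate_add (h : SubadditiveProcess τ a C) {ε : ℝ} (hε : 0 ≤ ε) (ω : Ω) :
    C ≤ lowerRate a ω + ε + 2 * C := by
  linarith [h.neg_le_lowerRate ω]

lemma exists_block_le (h : SubadditiveProcess τ a C) {ε : ℝ} (hε : 0 ≤ ε) (N : ℕ) (ω : Ω) :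
    ∃ k ∈ Set.Icc 1 (max 1 N), a k ω ≤ k * (lowerRate a ω + ε) +
      2 * C * birkhoffSum τ ((highSet a ε N).indicator (1 : Ω → ℝ)) k ω := by
  by_cases hω : ω ∈ highSet a ε N
  · refine ⟨1, ⟨le_rfl, le_max_left _ _⟩, ?_⟩
    simp only [Nat.cast_one, one_mul, birkhoffSum_one, Set.indicator_of_mem hω, Pi.one_apply,
      mul_one]
    exact ((le_abs_self _).trans (h.abs_one_le ω)).trans (h.const_le_lowerRate_add hε ω)
  · simp only [highSet, Set.mem_ofPred_eq, not_forall, not_lt] at hω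
    obtain ⟨k, hk, hak⟩ := hω
    have hC : 0 ≤ C := (abs_nonneg _).trans (h.abs_one_le ω)
    exact ⟨k, ⟨hk.1, hk.2.trans (le_max_right _ _)⟩, hak.trans <| le_add_of_nonneg_right <|
      mul_nonneg (by positivity) (birkhoffSum_indicator_one_nonneg _ k ω)⟩

/- Cut the orbit segment of length `n` into the blocks just found, stopping when at most `N` steps
are left. -/
lemma le_of_forall_lowerRate_iterate_eq (h : SubadditiveProcess τ a C) {ε : ℝ} (hε : 0 ≤ ε)
    (N n : ℕ) (ω : Ω) (hω : ∀ i, lowerRate a (τ^[i] ω) = lowerRate a ω) :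
    a n ω ≤ n * (lowerRate a ω + ε) +
      2 * C * (birkhoffSum τ ((highSet a ε N).indicator (1 : Ω → ℝ)) n ω + N) := by
  induction n using Nat.strong_induction_on generalizing ω with
  | _ n ih =>
    rcases le_or_gt n N with hnN | hnN
    · have hC : 0 ≤ C := (abs_nonneg _).trans (h.abs_one_le ω)
      calc a n ω ≤ n * C := (le_abs_self _).trans (h.abs_le_mul n ω)
        _ ≤ n * (lowerRate a ω + ε + 2 * C) := by
          gcongr
          exact h.const_le_lowerRate_add hε ω
        _ = n * (lowerRate a ω + ε) + 2 * C * n := by ring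
        _ ≤ _ := by
          gcongr
          exact (Nat.cast_le.2 hnN).trans
            (le_add_of_nonneg_left (birkhoffSum_indicator_one_nonneg _ n ω))
    · obtain ⟨k, ⟨hk, hkN⟩, block_le⟩ := h.exists_block_le hε N ω
      obtain ⟨l, rfl⟩ : ∃ l, n = k + l := Nat.exists_eq_add_of_le (by omega)
      have remainder_le := ih l (by omega) (τ^[k] ω) fun i => by
        rw [← Function.iterate_add_apply, hω, hω]
      rw [hω] at remainder_le
      rw [birkhoffSum_add]
      push_cast
      linarith [h.add_le k l ω]

lemma integral_le (h : SubadditiveProcess τ a C) (hτ : MeasurePreserving τ P P) {ε : ℝ}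
    (hε : 0 ≤ ε) (N n : ℕ) :
    ∫ ω, a n ω ∂P ≤ n * (∫ ω, lowerRate a ω ∂P + ε) +
      2 * C * (n * P.real (highSet a ε N) + N) := by
  have hH := h.measurableSet_highSet ε N
  have integrable_indicator : Integrable ((highSet a ε N).indicator (1 : Ω → ℝ)) P :=
    (integrable_const 1).indicator hH
  have integrable_rate : Integrable (fun ω => n * (lowerRate a ω + ε)) P :=
    ((h.integrable_lowerRate P).add (integrable_const ε)).const_mul _
  have integrable_visits : Integrable
      (fun ω => 2 * C * (birkhoffSum τ ((highSet a ε N).indicator (1 : Ω → ℝ)) n ω + N)) P :=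
    ((integrable_birkhoffSum hτ integrable_indicator n).add (integrable_const _)).const_mul _
  calc ∫ ω, a n ω ∂P
      ≤ ∫ ω, (n * (lowerRate a ω + ε) +
          2 * C * (birkhoffSum τ ((highSet a ε N).indicator (1 : Ω → ℝ)) n ω + N)) ∂P := by
        refine integral_mono_ae (h.integrable P n) (integrable_rate.add integrable_visits) ?_
        filter_upwards [h.ae_lowerRate_iterate hτ] with ω hω
        exact h.le_of_forall_lowerRate_iterate_eq hε N n ω hω
    _ = n * (∫ ω, lowerRate a ω ∂P + ε) + 2 * C * (n * P.real (highSet a ε N) + N) := by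
        rw [integral_add integrable_rate integrable_visits, integral_const_mul, integral_const_mul,
          integral_add (h.integrable_lowerRate P) (integrable_const _),
          integral_add (integrable_birkhoffSum hτ integrable_indicator n) (integrable_const _),
          integral_birkhoffSum hτ integrable_indicator, integral_indicator_one hH]
        simp

lemma eventually_integral_div_le (h : SubadditiveProcess τ a C) (hτ : MeasurePreserving τ P P)
    {ε : ℝ} (hε : 0 < ε) :
    ∀ᶠ n : ℕ in atTop, (∫ ω, a n ω ∂P) / n ≤ ∫ ω, lowerRate a ω ∂P + ε := by
  have high_tendsto := ((h.tendsto_measureReal_highSet (P := P) (half_pos hε)).const_mul (2 * C))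
  rw [mul_zero] at high_tendsto
  obtain ⟨N, hN⟩ := (high_tendsto.eventually_lt_const (show 0 < ε / 4 by linarith)).exists
  have error_tendsto := tendsto_const_div_atTop_nhds_zero_nat (2 * C * N)
  filter_upwards [error_tendsto.eventually_lt_const (show 0 < ε / 4 by linarith),
    eventually_gt_atTop 0] with n hn hn0
  have : (0 : ℝ) < n := Nat.cast_pos.2 hn0
  calc (∫ ω, a n ω ∂P) / n
      ≤ (n * (∫ ω, lowerRate a ω ∂P + ε / 2) +
          2 * C * (n * P.real (highSet a (ε / 2) N) + N)) / n := by
        gcongr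
        exact h.integral_le hτ (half_pos hε).le N n
    _ = ∫ ω, lowerRate a ω ∂P + ε / 2 + 2 * C * P.real (highSet a (ε / 2) N) +
          2 * C * N / n := by
        field_simp
        ring
    _ ≤ ∫ ω, lowerRate a ω ∂P + ε := by linarith

end ProbabilityMeasure

end SubadditiveProcess

/- The pointwise ergodic theorem for `g`, in the direction needed here, is the bound on the lower
rate of the subadditive process of Birkhoff sums of `-g`. -/
lemma integral_upperRate_birkhoffSum_le {P : Measure Ω} [IsProbabilityMeasure P]
    (hτ : MeasurePreserving τ P P) {g : Ω → ℝ} (hg : Measurable g) {C : ℝ}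
    (hC : ∀ ω, |g ω| ≤ C) :
    ∫ ω, upperRate (birkhoffSum τ g) ω ∂P ≤ ∫ ω, g ω ∂P := by
  have hsum := subadditiveProcess_birkhoffSum hτ.measurable hg hC
  have hneg := subadditiveProcess_birkhoffSum hτ.measurable hg.neg (C := C) (by simpa using hC)
  have hgP : Integrable g P := .of_bound hg.aestronglyMeasurable C (.of_forall hC)
  have upperRate_le_neg_lowerRate (ω : Ω) :
      upperRate (birkhoffSum τ g) ω ≤ -lowerRate (birkhoffSum τ (-g)) ω := by
    refine le_of_forall_pos_le_add fun δ hδ => hsum.upperRate_le ?_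
    filter_upwards [hneg.eventually_lt_div (ω := ω) (sub_lt_self _ hδ)] with n hn
    rw [birkhoffSum_neg, neg_div] at hn
    linarith
  have neg_integral_le : -∫ ω, g ω ∂P ≤ ∫ ω, lowerRate (birkhoffSum τ (-g)) ω ∂P := by
    refine le_of_forall_pos_le_add fun ε hε => ?_
    obtain ⟨n, hn, hn0⟩ := ((hneg.eventually_integral_div_le hτ hε).and
      (eventually_ne_atTop 0)).exists
    rwa [integral_birkhoffSum hτ hgP.neg, mul_div_cancel_left₀ _ (Nat.cast_ne_zero.2 hn0),
      integral_neg'] at hn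
  calc ∫ ω, upperRate (birkhoffSum τ g) ω ∂P
      ≤ ∫ ω, -lowerRate (birkhoffSum τ (-g)) ω ∂P :=
        integral_mono (hsum.integrable_upperRate P) (hneg.integrable_lowerRate P).neg
          upperRate_le_neg_lowerRate
    _ ≤ ∫ ω, g ω ∂P := by
        rw [integral_neg]
        linarith

namespace SubadditiveProcess

variable {a : ℕ → Ω → ℝ} {C : ℝ}

lemma le_birkhoffSum (h : SubadditiveProcess τ a C) (m q : ℕ) (ω : Ω) :
    a (m * q) ω ≤ birkhoffSum τ^[m] (a m) q ω := by
  induction q with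
  | zero => simpa using (le_abs_self _).trans (h.abs_le_mul 0 ω)
  | succ q ih =>
    rw [birkhoffSum_succ, Nat.mul_succ, ← Function.iterate_mul]
    exact (h.add_le (m * q) m ω).trans (by gcongr)

lemma div_le_birkhoffSum_div (h : SubadditiveProcess τ a C) {m n : ℕ} (hm : 0 < m) (hmn : m ≤ n)
    (ω : Ω) : a n ω / n ≤
      birkhoffSum τ^[m] (a m) (n / m) ω / (n / m : ℕ) / m + 2 * C * m / n := by
  set q := n / m
  set b := birkhoffSum τ^[m] (a m) q ω
  have : (0 : ℝ) < m := Nat.cast_pos.2 hm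
  have hn' : (0 : ℝ) < n := Nat.cast_pos.2 (hm.trans_le hmn)
  have hq' : (0 : ℝ) < q := Nat.cast_pos.2 (Nat.div_pos hmn hm)
  have hC : 0 ≤ C := (abs_nonneg _).trans (h.abs_one_le ω)
  have neg_le : -C ≤ b / q / m := by
    rw [div_div, le_div_iff₀ (by positivity)]
    linarith [(abs_le.1 (abs_birkhoffSum_le (τ := τ^[m]) (h.abs_le_mul m) q ω)).1]
  have remainder_le : a n ω ≤ b + (n % m : ℕ) * C := by
    have := h.add_le (m * q) (n % m) ω
    rw [Nat.div_add_mod] at this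
    linarith [h.le_birkhoffSum m q ω, (abs_le.1 (h.abs_le_mul (n % m) (τ^[m * q] ω))).2]
  have hnq : (m * q : ℝ) + (n % m : ℕ) = n := by exact_mod_cast Nat.div_add_mod n m
  calc a n ω / n ≤ (b + (n % m : ℕ) * C) / n := by gcongr
    _ = (((m * q : ℝ) + (n % m : ℕ)) * (b / q / m) + (n % m : ℕ) * (C - b / q / m)) / n := by
      congr 1
      field_simp
      ring
    _ ≤ (n * (b / q / m) + (n % m : ℕ) * (2 * C)) / n := by
      rw [hnq]
      gcongr
      linarith
    _ ≤ (n * (b / q / m) + m * (2 * C)) / n := by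
      gcongr
      exact (Nat.mod_lt n hm).le
    _ = b / q / m + 2 * C * m / n := by
      field_simp

lemma upperRate_le_upperRate_birkhoffSum (h : SubadditiveProcess τ a C) (hτ : Measurable τ) {m : ℕ}
    (hm : 0 < m) (ω : Ω) : upperRate a ω ≤ upperRate (birkhoffSum τ^[m] (a m)) ω / m := by
  have : (0 : ℝ) < m := Nat.cast_pos.2 hm
  have hb := subadditiveProcess_birkhoffSum (hτ.iterate m) (h.measurable m) (h.abs_le_mul m)
  refine le_of_forall_pos_le_add fun δ hδ => h.upperRate_le ?_
  have block_lt : ∀ᶠ n : ℕ in atTop, birkhoffSum τ^[m] (a m) (n / m) ω / (n / m : ℕ) <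
      upperRate (birkhoffSum τ^[m] (a m)) ω + δ / 2 * m :=
    (Nat.tendsto_div_const_atTop hm.ne').eventually
      (hb.eventually_div_lt (lt_add_of_pos_right _ (by positivity)))
  have error_lt : ∀ᶠ n : ℕ in atTop, 2 * C * m / n < δ / 2 :=
    (tendsto_const_div_atTop_nhds_zero_nat _).eventually_lt_const (half_pos hδ)
  filter_upwards [block_lt, error_lt, eventually_ge_atTop m] with n hblock herror hmn
  calc a n ω / n
      ≤ birkhoffSum τ^[m] (a m) (n / m) ω / (n / m : ℕ) / m + 2 * C * m / n :=
        h.div_le_birkhoffSum_div hm hmn ω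
    _ ≤ (upperRate (birkhoffSum τ^[m] (a m)) ω + δ / 2 * m) / m + δ / 2 := by gcongr
    _ = upperRate (birkhoffSum τ^[m] (a m)) ω / m + δ := by
        field_simp
        ring

variable {P : Measure Ω} [IsProbabilityMeasure P]

lemma integral_upperRate_le (h : SubadditiveProcess τ a C) (hτ : MeasurePreserving τ P P) {m : ℕ}
    (hm : 0 < m) : ∫ ω, upperRate a ω ∂P ≤ (∫ ω, a m ω ∂P) / m := by
  have hb := subadditiveProcess_birkhoffSum (hτ.measurable.iterate m) (h.measurable m)
    (h.abs_le_mul m)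
  calc ∫ ω, upperRate a ω ∂P
      ≤ ∫ ω, upperRate (birkhoffSum τ^[m] (a m)) ω / m ∂P :=
        integral_mono (h.integrable_upperRate P) ((hb.integrable_upperRate P).div_const _)
          (h.upperRate_le_upperRate_birkhoffSum hτ.measurable hm)
    _ = (∫ ω, upperRate (birkhoffSum τ^[m] (a m)) ω ∂P) / m := integral_div _ _
    _ ≤ (∫ ω, a m ω ∂P) / m := by
        exact div_le_div_of_nonneg_right
          (integral_upperRate_birkhoffSum_le (hτ.iterate m) (h.measurable m) (h.abs_le_mul m))
          m.cast_nonneg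

theorem ae_tendsto_div (h : SubadditiveProcess τ a C) (hτ : MeasurePreserving τ P P) :
    ∀ᵐ ω ∂P, Tendsto (fun n : ℕ => a n ω / n) atTop (𝓝 (lowerRate a ω)) := by
  have integral_upperRate_le_integral_lowerRate :
      ∫ ω, upperRate a ω ∂P ≤ ∫ ω, lowerRate a ω ∂P := by
    refine le_of_forall_pos_le_add fun ε hε => ?_
    obtain ⟨m, hm, hm0⟩ := ((h.eventually_integral_div_le hτ hε).and
      (eventually_gt_atTop 0)).exists
    exact (h.integral_upperRate_le hτ hm0).trans hm
  have lowerRate_ae_eq : lowerRate a =ᵐ[P] upperRate a :=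
    (integral_eq_iff_of_ae_le (h.integrable_lowerRate P) (h.integrable_upperRate P)
      (.of_forall h.lowerRate_le_upperRate)).1 <|
      (integral_mono (h.integrable_lowerRate P) (h.integrable_upperRate P)
        h.lowerRate_le_upperRate).antisymm integral_upperRate_le_integral_lowerRate
  filter_upwards [lowerRate_ae_eq] with ω hω
  exact tendsto_of_liminf_eq_limsup rfl hω.symm (h.isBoundedUnder_le ω) (h.isBoundedUnder_ge ω)

lemma tendsto_integral_div (h : SubadditiveProcess τ a C) (hτ : MeasurePreserving τ P P) :
    Tendsto (fun n : ℕ => (∫ ω, a n ω ∂P) / n) atTop (𝓝 (∫ ω, lowerRate a ω ∂P)) := by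
  simp only [← integral_div]
  exact tendsto_integral_of_dominated_convergence (fun _ => C)
    (fun n => ((h.measurable n).div_const _).aestronglyMeasurable) (integrable_const C)
    (fun n => .of_forall (h.abs_div_le n)) (h.ae_tendsto_div hτ)

end SubadditiveProcess

end SubadditiveErgodicTheorem

section MidpointConvex

variable {H : Type*} [NormedAddCommGroup H] [InnerProductSpace ℝ H]

lemma norm_sub_sq_le_of_le_norm_midpoint_sq {x y : H} {b c : ℝ} (hx : ‖x‖ ^ 2 ≤ b)
    (hy : ‖y‖ ^ 2 ≤ b) (hc : c ≤ ‖(2⁻¹ : ℝ) • (x + y)‖ ^ 2) : ‖x - y‖ ^ 2 ≤ 4 * (b - c) := by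
  have norm_midpoint_sq : ‖(2⁻¹ : ℝ) • (x + y)‖ ^ 2 = ‖x + y‖ ^ 2 / 4 := by
    rw [norm_smul, mul_pow]
    norm_num
    ring
  linarith [parallelogram_law_with_norm ℝ x y]

/- As in the Hilbert projection theorem: points of `C n` of almost minimal norm are close to each
other by the parallelogram law, and the minimal norms increase to a finite limit. -/
lemma exists_cauchySeq_of_midpoint_mem {C : ℕ → Set H} (hanti : Antitone C)
    (hne : ∀ n, (C n).Nonempty) (hmid : ∀ n, ∀ x ∈ C n, ∀ y ∈ C n, (2⁻¹ : ℝ) • (x + y) ∈ C n)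
    {r : ℝ} (hr : ∀ n, ∀ x ∈ C n, ‖x‖ ≤ r) : ∃ x : ℕ → H, (∀ n, x n ∈ C n) ∧ CauchySeq x := by
  let I : ℕ → ℝ := fun n => sInf ((fun x : H => ‖x‖ ^ 2) '' C n)
  have bddBelow n : BddBelow ((fun x : H => ‖x‖ ^ 2) '' C n) :=
    ⟨0, Set.forall_mem_image.2 fun x _ => sq_nonneg ‖x‖⟩
  have I_le n x (hx : x ∈ C n) : I n ≤ ‖x‖ ^ 2 :=
    csInf_le (bddBelow n) (Set.mem_image_of_mem _ hx)
  have monotone_I : Monotone I := fun n m hnm =>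
    csInf_le_csInf (bddBelow n) ((hne m).image _) (Set.image_mono (hanti hnm))
  have bddAbove_I : BddAbove (Set.range I) := ⟨r ^ 2, Set.forall_mem_range.2 fun n =>
    (hne n).elim fun x hx => (I_le n x hx).trans (pow_le_pow_left₀ (norm_nonneg _) (hr n x hx) 2)⟩
  have exists_lt (n : ℕ) : ∃ x ∈ C n, ‖x‖ ^ 2 < I n + 1 / ((n : ℝ) + 1) := by
    simpa only [Set.exists_mem_image] using exists_lt_of_csInf_lt ((hne n).image _)
      (lt_add_of_pos_right (I n) Nat.one_div_pos_of_nat)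
  choose x hxC hx using exists_lt
  let L : ℝ := ⨆ n, I n
  have norm_sq_le (N k : ℕ) (hk : N ≤ k) : ‖x k‖ ^ 2 ≤ L + 1 / ((N : ℝ) + 1) :=
    (hx k).le.trans (add_le_add (le_ciSup bddAbove_I k) (Nat.one_div_le_one_div hk))
  refine ⟨x, hxC, cauchySeq_of_le_tendsto_0
    (fun N => √(4 * (L + 1 / ((N : ℝ) + 1) - I N))) (fun n m N hn hm => ?_) ?_⟩
  · rw [dist_eq_norm]
    exact Real.le_sqrt_of_sq_le <| norm_sub_sq_le_of_le_norm_midpoint_sq (norm_sq_le N n hn)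
      (norm_sq_le N m hm) (I_le N _ (hmid N _ (hanti hn (hxC n)) _ (hanti hm (hxC m))))
  · simpa [L] using (((tendsto_one_div_add_atTop_nhds_zero_nat.const_add L).sub
      (tendsto_atTop_ciSup monotone_I bddAbove_I)).const_mul 4).sqrt

end MidpointConvex

section WeakConvergence

open ProbabilityTheory BoundedContinuousFunction

variable {Ω X : Type*} [MeasurableSpace Ω] {P : Measure Ω} [MetricSpace X]
  [MeasurableSpace X] [BorelSpace X]

lemma lipschitzWith_integral (μ : Measure X) [IsProbabilityMeasure μ] :
    LipschitzWith 1 fun f : X →ᵇ ℝ => ∫ x, f x ∂μ :=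
  .of_dist_le_mul fun f g => by
    rw [NNReal.coe_one, one_mul, dist_eq_norm, dist_eq_norm,
      ← integral_sub (f.integrable μ) (g.integrable μ)]
    exact (f - g).norm_integral_le_norm μ

/- By compactness there is a limit along an ultrafilter. -/
lemma exists_tendsto_probabilityMeasure [CompactSpace X] {p : ℕ → ProbabilityMeasure X}
    {d : ℕ → X →ᵇ ℝ} (hd : DenseRange d)
    (h : ∀ j, ∃ c, Tendsto (fun n => ∫ x, d j x ∂(p n : Measure X)) atTop (𝓝 c)) :
    ∃ ν : ProbabilityMeasure X, Tendsto p atTop (𝓝 ν) := by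
  obtain ⟨ν, -, hν⟩ := isCompact_univ.ultrafilter_le_nhds ((hyperfilter ℕ).map p) (by simp)
  have tendsto_dense j : Tendsto (fun n => ∫ x, d j x ∂(p n : Measure X)) atTop
      (𝓝 (∫ x, d j x ∂(ν : Measure X))) := by
    obtain ⟨c, hc⟩ := h j
    rwa [← tendsto_nhds_unique (hc.mono_left Nat.hyperfilter_le_atTop)
      (ProbabilityMeasure.tendsto_iff_forall_integral_tendsto.1 hν (d j))]
  have isClosed_tendsto := Equicontinuous.isClosed_setOfPred_tendsto (l := atTop)
    (LipschitzWith.uniformEquicontinuous _ 1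
      fun n => lipschitzWith_integral (p n : Measure X)).equicontinuous
    (lipschitzWith_integral (ν : Measure X)).continuous
  exact ⟨ν, ProbabilityMeasure.tendsto_iff_forall_integral_tendsto.2 fun f =>
    isClosed_tendsto.closure_subset_iff.2 (Set.range_subset_iff.2 tendsto_dense) (hd f)⟩

lemma measurable_of_forall_measurable_integral {ν : Ω → Measure X}
    [∀ ω, IsProbabilityMeasure (ν ω)] (h : ∀ f : X →ᵇ ℝ, Measurable fun ω => ∫ x, f x ∂ν ω) :
    Measurable ν := by
  refine Measurable.measure_of_isPiSystem_of_isProbabilityMeasure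
    (BorelSpace.measurable_eq.trans borel_eq_generateFrom_isClosed) isPiSystem_isClosed
    fun F hF => ?_
  have hF : IsClosed F := hF
  refine measurable_of_tendsto_metrizable (f := fun n ω => ∫⁻ x, hF.apprSeq n x ∂ν ω)
    (fun n => ?_) (tendsto_pi_nhds.2 fun ω =>
      HasOuterApproxClosed.tendsto_lintegral_apprSeq hF (ν ω))
  let f : X →ᵇ ℝ := BoundedContinuousFunction.comp _ NNReal.isometry_coe.lipschitz (hF.apprSeq n)
  have lintegral_eq ω : ∫⁻ x, hF.apprSeq n x ∂ν ω = ENNReal.ofReal (∫ x, f x ∂ν ω) := by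
    rw [ofReal_integral_eq_lintegral_ofReal (f.integrable _)
      (.of_forall fun x => NNReal.coe_nonneg _)]
    exact lintegral_congr fun x => ENNReal.ofReal_coe_nnreal.symm
  simpa only [lintegral_eq] using (h f).ennreal_ofReal

/-- Almost everywhere weak convergence of the measures `κ n ω` to `η ω`. -/
def AETendstoWeakly (P : Measure Ω) (κ : ℕ → Kernel Ω X) (η : Kernel Ω X) : Prop :=
  ∀ᵐ ω ∂P, ∀ f : X →ᵇ ℝ, Tendsto (fun n => ∫ x, f x ∂κ n ω) atTop (𝓝 (∫ x, f x ∂η ω))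

lemma exists_aetendstoWeakly_of_forall_tendsto {κ : ℕ → Kernel Ω X}
    [∀ n, IsMarkovKernel (κ n)]
    (h : ∀ ω, ∃ ν : ProbabilityMeasure X, ∀ f : X →ᵇ ℝ,
      Tendsto (fun n => ∫ x, f x ∂κ n ω) atTop (𝓝 (∫ x, f x ∂(ν : Measure X)))) :
    ∃ η : Kernel Ω X, IsMarkovKernel η ∧ AETendstoWeakly P κ η := by
  choose ν hν using h
  have measurable_limit : Measurable fun ω => (ν ω : Measure X) :=
    measurable_of_forall_measurable_integral fun f =>
      measurable_of_tendsto_metrizable (f := fun n ω => ∫ x, f x ∂κ n ω)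
        (fun n => f.continuous.stronglyMeasurable.integral_kernel.measurable)
        (tendsto_pi_nhds.2 fun ω => hν ω f)
  exact ⟨⟨fun ω => ν ω, measurable_limit⟩, ⟨fun ω => (ν ω).2⟩, .of_forall hν⟩

lemma exists_aetendstoWeakly [CompactSpace X] {κ : ℕ → Kernel Ω X} [∀ n, IsMarkovKernel (κ n)]
    {d : ℕ → X →ᵇ ℝ} (hd : DenseRange d)
    (h : ∀ᵐ ω ∂P, ∀ j, ∃ c, Tendsto (fun n => ∫ x, d j x ∂κ n ω) atTop (𝓝 c)) :
    ∃ η : Kernel Ω X, IsMarkovKernel η ∧ AETendstoWeakly P κ η := by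
  classical
  let G : Set Ω := {ω | ∀ j, ∃ c, Tendsto (fun n => ∫ x, d j x ∂κ n ω) atTop (𝓝 c)}
  have measurableSet_G : MeasurableSet G := by
    simp only [G, Set.ofPred_forall]
    exact MeasurableSet.iInter fun j => measurableSet_exists_tendsto fun n =>
      (d j).continuous.stronglyMeasurable.integral_kernel.measurable
  let κ' n : Kernel Ω X := Kernel.piecewise measurableSet_G (κ n) (κ 0)
  have eq_of_mem n ω (hω : ω ∈ G) : κ' n ω = κ n ω := if_pos hω
  have eq_of_notMem n ω (hω : ω ∉ G) : κ' n ω = κ 0 ω := if_neg hω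
  obtain ⟨η, hη, tendsto_η⟩ : ∃ η : Kernel Ω X, IsMarkovKernel η ∧ AETendstoWeakly P κ' η := by
    refine exists_aetendstoWeakly_of_forall_tendsto fun ω => ?_
    have exists_limit j : ∃ c, Tendsto (fun n => ∫ x, d j x ∂κ' n ω) atTop (𝓝 c) := by
      by_cases hω : ω ∈ G
      · simpa only [eq_of_mem _ ω hω] using hω j
      · simpa only [eq_of_notMem _ ω hω] using ⟨_, tendsto_const_nhds⟩
    exact (exists_tendsto_probabilityMeasure (p := fun n => ⟨κ' n ω, inferInstance⟩) hd
      exists_limit).imp fun ν hν => ProbabilityMeasure.tendsto_iff_forall_integral_tendsto.1 hν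
  refine ⟨η, hη, ?_⟩
  filter_upwards [h, tendsto_η] with ω hω tendsto_ω
  simpa only [eq_of_mem _ ω hω] using tendsto_ω

end WeakConvergence

section MidpointConvexKernels

open ProbabilityTheory BoundedContinuousFunction

variable {Ω X : Type*} [MeasurableSpace Ω] [MeasurableSpace X]

lemma isProbabilityMeasure_of_fst_eq {P : Measure Ω} [IsProbabilityMeasure P]
    {μ : Measure (Ω × X)} (h : μ.fst = P) : IsProbabilityMeasure μ :=
  ⟨by rw [← Measure.fst_univ, h, measure_univ]⟩

/-- The midpoint of two kernels. -/
def kernelMidpoint (κ η : Kernel Ω X) : Kernel Ω X where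
  toFun ω := (2⁻¹ : ENNReal) • (κ ω + η ω)
  measurable' := Measure.measurable_of_measurable_coe _ fun _ hs =>
    ((κ.measurable_coe hs).add (η.measurable_coe hs)).const_mul _

lemma kernelMidpoint_apply (κ η : Kernel Ω X) (ω : Ω) :
    kernelMidpoint κ η ω = (2⁻¹ : ENNReal) • (κ ω + η ω) := rfl

instance isMarkovKernel_kernelMidpoint (κ η : Kernel Ω X) [IsMarkovKernel κ] [IsMarkovKernel η] :
    IsMarkovKernel (kernelMidpoint κ η) where
  isProbabilityMeasure ω := ⟨by
    rw [kernelMidpoint_apply, Measure.smul_apply, Measure.add_apply, measure_univ, measure_univ,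
      one_add_one_eq_two, smul_eq_mul, ENNReal.inv_mul_cancel two_ne_zero ENNReal.ofNat_ne_top]⟩

lemma compProd_kernelMidpoint (P : Measure Ω) [SFinite P] (κ η : Kernel Ω X) [IsMarkovKernel κ]
    [IsMarkovKernel η] : P.compProd (kernelMidpoint κ η) =
      (2⁻¹ : ENNReal) • (P.compProd κ + P.compProd η) := by
  ext A hA
  have measurable_κ := Kernel.measurable_kernel_prodMk_left (κ := κ) hA
  have measurable_η := Kernel.measurable_kernel_prodMk_left (κ := η) hA
  rw [Measure.compProd_apply hA, Measure.smul_apply, Measure.add_apply, Measure.compProd_apply hA,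
    Measure.compProd_apply hA, ← lintegral_add_left measurable_κ, smul_eq_mul]
  exact lintegral_const_mul _ (measurable_κ.add measurable_η)

variable [MetricSpace X] [BorelSpace X]

/-- The integrals of countably many test functions against a kernel, scaled to lie in `[-1, 1]`.
They embed the kernels affinely into a Hilbert space. -/
def testIntegral (d : ℕ → X →ᵇ ℝ) (κ : Kernel Ω X) (q : Ω × ℕ) : ℝ :=
  (1 + ‖d q.2‖)⁻¹ * ∫ x, d q.2 x ∂κ q.1

variable (d : ℕ → X →ᵇ ℝ)

lemma measurable_testIntegral (κ : Kernel Ω X) : Measurable (testIntegral d κ) :=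
  measurable_from_prod_countable_left fun j =>
    ((d j).continuous.stronglyMeasurable.integral_kernel (κ := κ)).measurable.const_mul
      (1 + ‖d j‖)⁻¹

lemma norm_testIntegral_le_one (κ : Kernel Ω X) [IsMarkovKernel κ] (q : Ω × ℕ) :
    ‖testIntegral d κ q‖ ≤ 1 := by
  have weight_pos : 0 < 1 + ‖d q.2‖ := by positivity
  rw [testIntegral, norm_mul, norm_inv, Real.norm_of_nonneg weight_pos.le]
  exact inv_mul_le_one_of_le₀ (((d q.2).norm_integral_le_norm _).trans
    (le_add_of_nonneg_left zero_le_one)) weight_pos.le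

lemma memLp_testIntegral (κ : Kernel Ω X) [IsMarkovKernel κ] (Q : Measure (Ω × ℕ))
    [IsFiniteMeasure Q] : MemLp (testIntegral d κ) 2 Q :=
  .of_bound (measurable_testIntegral d κ).aestronglyMeasurable 1
    (.of_forall (norm_testIntegral_le_one d κ))

lemma testIntegral_kernelMidpoint (κ η : Kernel Ω X) [IsMarkovKernel κ] [IsMarkovKernel η]
    (q : Ω × ℕ) : testIntegral d (kernelMidpoint κ η) q =
      2⁻¹ * (testIntegral d κ q + testIntegral d η q) := by
  simp only [testIntegral, kernelMidpoint_apply, integral_smul_measure, integral_add_measure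
    ((d q.2).integrable _) ((d q.2).integrable _), ENNReal.toReal_inv, ENNReal.toReal_ofNat,
    smul_eq_mul]
  ring

variable {d} {K : ℕ → Set (Kernel Ω X)}

lemma exists_ae_tendsto_testIntegral (Q : Measure (Ω × ℕ)) [IsFiniteMeasure Q] (hanti : Antitone K)
    (hne : ∀ n, (K n).Nonempty) (hmarkov : ∀ n, ∀ κ ∈ K n, IsMarkovKernel κ)
    (hmid : ∀ n, ∀ κ ∈ K n, ∀ η ∈ K n, kernelMidpoint κ η ∈ K n) :
    ∃ κ : ℕ → Kernel Ω X, (∀ n, κ n ∈ K n) ∧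
      ∀ᵐ q ∂Q, ∃ c, Tendsto (fun n => testIntegral d (κ n) q) atTop (𝓝 c) := by
  let C n : Set (Lp ℝ 2 Q) := {v | ∃ κ ∈ K n, v =ᵐ[Q] testIntegral d κ}
  have nonempty_C n : (C n).Nonempty := by
    obtain ⟨κ, hκ⟩ := hne n
    have := hmarkov n κ hκ
    exact ⟨(memLp_testIntegral d κ Q).toLp, κ, hκ, MemLp.coeFn_toLp _⟩
  have midpoint_mem n : ∀ v ∈ C n, ∀ w ∈ C n, (2⁻¹ : ℝ) • (v + w) ∈ C n := by
    rintro v ⟨κ, hκ, hv⟩ w ⟨η, hη, hw⟩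
    have := hmarkov n κ hκ
    have := hmarkov n η hη
    refine ⟨kernelMidpoint κ η, hmid n κ hκ η hη, ?_⟩
    filter_upwards [hv, hw, Lp.coeFn_smul (2⁻¹ : ℝ) (v + w), Lp.coeFn_add v w]
      with q hvq hwq hsmul hadd
    rw [hsmul, Pi.smul_apply, hadd, Pi.add_apply, hvq, hwq, testIntegral_kernelMidpoint,
      smul_eq_mul]
  have norm_le n : ∀ v ∈ C n, ‖v‖ ≤ measureUnivNNReal Q ^ (2 : ENNReal).toReal⁻¹ * 1 := by
    rintro v ⟨κ, hκ, hv⟩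
    have := hmarkov n κ hκ
    refine Lp.norm_le_of_ae_bound zero_le_one ?_
    filter_upwards [hv] with q hq
    exact hq ▸ norm_testIntegral_le_one d κ q
  obtain ⟨v, hvC, hcauchy⟩ := exists_cauchySeq_of_midpoint_mem (C := C)
    (fun n m hnm v ⟨κ, hκ, hv⟩ => ⟨κ, hanti hnm hκ, hv⟩) nonempty_C midpoint_mem norm_le
  choose κ hκ hvκ using hvC
  obtain ⟨V, hV⟩ := cauchySeq_tendsto_of_complete hcauchy
  obtain ⟨φ, hφ, tendsto_V⟩ := (tendstoInMeasure_of_tendsto_Lp hV).exists_seq_tendsto_ae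
  refine ⟨fun n => κ (φ n), fun n => hanti (hφ.id_le n) (hκ _), ?_⟩
  filter_upwards [tendsto_V, ae_all_iff.2 fun n => hvκ (φ n)] with q hq heq
  exact ⟨V q, by simpa only [heq] using hq⟩

lemma ae_forall_of_ae_prod_count {P : Measure Ω} {p : Ω × ℕ → Prop}
    (h : ∀ᵐ q ∂P.prod (Measure.count : Measure ℕ).toFinite, p q) : ∀ᵐ ω ∂P, ∀ j, p (ω, j) := by
  filter_upwards [Measure.ae_ae_of_ae_prod h] with ω hω
  rw [ae_toFinite] at hω
  simpa using hω

theorem exists_aetendstoWeakly_of_kernelMidpoint_mem [CompactSpace X] (P : Measure Ω)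
    [IsFiniteMeasure P] (hanti : Antitone K) (hne : ∀ n, (K n).Nonempty)
    (hmarkov : ∀ n, ∀ κ ∈ K n, IsMarkovKernel κ)
    (hmid : ∀ n, ∀ κ ∈ K n, ∀ η ∈ K n, kernelMidpoint κ η ∈ K n) :
    ∃ (κ : ℕ → Kernel Ω X) (η : Kernel Ω X),
      (∀ n, κ n ∈ K n) ∧ IsMarkovKernel η ∧ AETendstoWeakly P κ η := by
  let toBounded := ContinuousMap.isometryEquivBoundedOfCompact X ℝ
  let d : ℕ → X →ᵇ ℝ := toBounded ∘ TopologicalSpace.denseSeq C(X, ℝ)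
  have denseRange_d : DenseRange d := toBounded.surjective.denseRange.comp
    (TopologicalSpace.denseRange_denseSeq _) toBounded.continuous
  obtain ⟨κ, hκ, tendsto_testIntegral⟩ := exists_ae_tendsto_testIntegral (d := d)
    (P.prod (Measure.count : Measure ℕ).toFinite) hanti hne hmarkov hmid
  have := fun n => hmarkov n (κ n) (hκ n)
  obtain ⟨η, hη, tendsto_η⟩ := exists_aetendstoWeakly (P := P) (κ := κ) denseRange_d <| by
    filter_upwards [ae_forall_of_ae_prod_count tendsto_testIntegral] with ω hω j
    obtain ⟨c, hc⟩ := hω j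
    refine ⟨(1 + ‖d j‖) * c, ?_⟩
    simpa only [testIntegral, mul_inv_cancel_left₀ (by positivity : 1 + ‖d j‖ ≠ 0)]
      using hc.const_mul (1 + ‖d j‖)
  exact ⟨κ, η, hκ, hη, tendsto_η⟩

theorem exists_aetendstoWeakly_compProd_mem [CompactSpace X] {P : Measure Ω}
    [IsProbabilityMeasure P] {M : ℕ → Set (Measure (Ω × X))} (hanti : Antitone M)
    (hne : ∀ n, (M n).Nonempty) (hfst : ∀ n, ∀ μ ∈ M n, μ.fst = P)
    (hmid : ∀ n, ∀ μ ∈ M n, ∀ ν ∈ M n, (2⁻¹ : ENNReal) • (μ + ν) ∈ M n) :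
    ∃ (κ : ℕ → Kernel Ω X) (η : Kernel Ω X), (∀ n, IsMarkovKernel (κ n)) ∧
      (∀ n, P.compProd (κ n) ∈ M n) ∧ IsMarkovKernel η ∧ AETendstoWeakly P κ η := by
  let K n : Set (Kernel Ω X) := {κ | IsMarkovKernel κ ∧ P.compProd κ ∈ M n}
  have nonempty_K n : (K n).Nonempty := by
    obtain ⟨μ, hμ⟩ := hne n
    have := isProbabilityMeasure_of_fst_eq (hfst n μ hμ)
    obtain ⟨_, x⟩ := nonempty_of_isProbabilityMeasure μ
    have : Nonempty X := ⟨x⟩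
    refine ⟨μ.condKernel, inferInstance, ?_⟩
    rwa [← hfst n μ hμ, μ.disintegrate μ.condKernel]
  obtain ⟨κ, η, hκ, hη, tendsto_η⟩ := exists_aetendstoWeakly_of_kernelMidpoint_mem P
    (K := K) (fun n m hnm κ hκ => ⟨hκ.1, hanti hnm hκ.2⟩) nonempty_K (fun n κ hκ => hκ.1)
    fun n κ ⟨_, hκ⟩ η ⟨_, hη⟩ => ⟨inferInstance, compProd_kernelMidpoint P κ η ▸ hmid n _ hκ _ hη⟩
  exact ⟨κ, η, fun n => (hκ n).1, fun n => (hκ n).2, hη, tendsto_η⟩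

end MidpointConvexKernels

section WeakLimits

open ProbabilityTheory BoundedContinuousFunction

variable {X : Type*} [MetricSpace X] [MeasurableSpace X] [BorelSpace X]

section Measure

variable {μ : ℕ → Measure X} {ν : Measure X} [∀ n, IsProbabilityMeasure (μ n)]
  [IsProbabilityMeasure ν] {A : Set X}

lemma limsup_measure_le_of_isClosed
    (h : ∀ f : X →ᵇ ℝ, Tendsto (fun n => ∫ x, f x ∂μ n) atTop (𝓝 (∫ x, f x ∂ν)))
    (hA : IsClosed A) : limsup (fun n => μ n A) atTop ≤ ν A :=
  ProbabilityMeasure.limsup_measure_closed_le_of_tendsto (μ := ⟨ν, inferInstance⟩)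
    (μs := fun n => ⟨μ n, inferInstance⟩)
    (ProbabilityMeasure.tendsto_iff_forall_integral_tendsto.2 h) hA

lemma ae_mem_of_isClosed
    (h : ∀ f : X →ᵇ ℝ, Tendsto (fun n => ∫ x, f x ∂μ n) atTop (𝓝 (∫ x, f x ∂ν)))
    (hA : IsClosed A) (hμ : ∀ n, ∀ᵐ x ∂μ n, x ∈ A) : ∀ᵐ x ∂ν, x ∈ A := by
  have limsup_le := limsup_measure_le_of_isClosed h hA
  simp only [fun n => (prob_compl_eq_zero_iff hA.measurableSet).1 (hμ n), limsup_const] at limsup_le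
  exact (prob_compl_eq_zero_iff hA.measurableSet).2 (prob_le_one.antisymm limsup_le)

lemma tendsto_integral_of_continuousOn [CompactSpace X]
    (h : ∀ f : X →ᵇ ℝ, Tendsto (fun n => ∫ x, f x ∂μ n) atTop (𝓝 (∫ x, f x ∂ν)))
    (hA : IsClosed A) (hμ : ∀ n, ∀ᵐ x ∂μ n, x ∈ A) {f : X → ℝ} (hf : ContinuousOn f A) :
    Tendsto (fun n => ∫ x, f x ∂μ n) atTop (𝓝 (∫ x, f x ∂ν)) := by
  obtain ⟨g, hg⟩ := ContinuousMap.exists_restrict_eq hA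
    (⟨A.domRestrict f, continuousOn_iff_continuous_domRestrict.1 hf⟩ : C(A, ℝ))
  have f_eq_g x (hx : x ∈ A) : f x = mkOfCompact g x := (DFunLike.congr_fun hg ⟨x, hx⟩).symm
  rw [integral_congr_ae ((ae_mem_of_isClosed h hA hμ).mono f_eq_g)]
  simpa only [integral_congr_ae ((hμ _).mono f_eq_g)] using h (mkOfCompact g)

end Measure

variable {Ω : Type*} [MeasurableSpace Ω] {P : Measure Ω} [IsFiniteMeasure P]
  {κ : ℕ → Kernel Ω X} {η : Kernel Ω X} [∀ n, IsMarkovKernel (κ n)] [IsMarkovKernel η]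
  {A : Set (Ω × X)}

lemma AETendstoWeakly.limsup_compProd_le (h : AETendstoWeakly P κ η) (hA : MeasurableSet A)
    (hclosed : ∀ ω, IsClosed (Prod.mk ω ⁻¹' A)) :
    limsup (fun n => P.compProd (κ n) A) atTop ≤ P.compProd η A := by
  simp only [Measure.compProd_apply hA]
  calc limsup (fun n => ∫⁻ ω, κ n ω (Prod.mk ω ⁻¹' A) ∂P) atTop
      ≤ ∫⁻ ω, limsup (fun n => κ n ω (Prod.mk ω ⁻¹' A)) atTop ∂P :=
        limsup_lintegral_le (fun _ => 1)
          (fun n => Kernel.measurable_kernel_prodMk_left hA)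
          (fun n => .of_forall fun ω => prob_le_one) (by simp)
    _ ≤ ∫⁻ ω, η ω (Prod.mk ω ⁻¹' A) ∂P := by
        refine lintegral_mono_ae ?_
        filter_upwards [h] with ω hω
        exact limsup_measure_le_of_isClosed hω (hclosed ω)

lemma AETendstoWeakly.ae_compProd_mem (h : AETendstoWeakly P κ η) (hA : MeasurableSet A)
    (hclosed : ∀ ω, IsClosed (Prod.mk ω ⁻¹' A)) (hκ : ∀ n, ∀ᵐ p ∂P.compProd (κ n), p ∈ A) :
    ∀ᵐ p ∂P.compProd η, p ∈ A := by
  refine Measure.ae_compProd_of_ae_ae hA ?_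
  filter_upwards [h, ae_all_iff.2 fun n => Measure.ae_ae_of_ae_compProd (hκ n)] with ω hω hκω
  exact ae_mem_of_isClosed hω (hclosed ω) hκω

lemma AETendstoWeakly.tendsto_integral_compProd [CompactSpace X] (h : AETendstoWeakly P κ η)
    (hclosed : ∀ ω, IsClosed (Prod.mk ω ⁻¹' A)) (hκ : ∀ n, ∀ᵐ p ∂P.compProd (κ n), p ∈ A)
    {f : Ω × X → ℝ} (hf : Measurable f) {c : ℝ} (hc : ∀ p, |f p| ≤ c)
    (hcont : ∀ᵐ ω ∂P, ContinuousOn (fun x => f (ω, x)) (Prod.mk ω ⁻¹' A)) :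
    Tendsto (fun n => ∫ p, f p ∂P.compProd (κ n)) atTop (𝓝 (∫ p, f p ∂P.compProd η)) := by
  have integrable (ζ : Kernel Ω X) [IsMarkovKernel ζ] : Integrable f (P.compProd ζ) :=
    .of_bound hf.aestronglyMeasurable c (.of_forall hc)
  have norm_le (ζ : Kernel Ω X) [IsMarkovKernel ζ] (ω : Ω) : ‖∫ x, f (ω, x) ∂ζ ω‖ ≤ c := by
    simpa using norm_integral_le_of_norm_le_const (μ := ζ ω) (f := fun x => f (ω, x)) (C := c)
      (.of_forall fun x => hc (ω, x))
  simp only [Measure.integral_compProd (integrable _)]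
  refine tendsto_integral_of_dominated_convergence (fun _ => c)
    (fun n => (hf.stronglyMeasurable.integral_kernel_prod_right' (κ := κ n)).aestronglyMeasurable)
    (integrable_const c) (fun n => .of_forall (norm_le (κ n))) ?_
  filter_upwards [h, hcont, ae_all_iff.2 fun n => Measure.ae_ae_of_ae_compProd (hκ n)]
    with ω hω hcontω hκω
  exact tendsto_integral_of_continuousOn hω (hclosed ω) hκω hcontω

lemma ext_of_forall_integral_indicator_mul {μ ν : Measure (Ω × X)} [IsFiniteMeasure μ]
    [IsFiniteMeasure ν]
    (h : ∀ F : Set Ω, MeasurableSet F → ∀ g : X →ᵇ ℝ,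
      ∫ p, F.indicator 1 p.1 * g p.2 ∂μ = ∫ p, F.indicator 1 p.1 * g p.2 ∂ν) : μ = ν := by
  refine Measure.ext_prod fun {F B} hF hB => ?_
  have snd_apply (ξ : Measure (Ω × X)) : (ξ.restrict (Prod.fst ⁻¹' F)).snd B = ξ (F ×ˢ B) := by
    rw [Measure.snd_apply hB, Measure.restrict_apply (measurable_snd hB), Set.inter_comm]
    rfl
  have integral_snd (ξ : Measure (Ω × X)) (g : X →ᵇ ℝ) :
      ∫ x, g x ∂(ξ.restrict (Prod.fst ⁻¹' F)).snd = ∫ p, F.indicator 1 p.1 * g p.2 ∂ξ := by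
    rw [Measure.snd,
      integral_map measurable_snd.aemeasurable g.continuous.measurable.aestronglyMeasurable,
      ← integral_indicator (measurable_fst hF)]
    refine integral_congr_ae (.of_forall fun p => ?_)
    by_cases hp : p.1 ∈ F <;> simp [hp, Set.indicator]
  have snd_eq : (μ.restrict (Prod.fst ⁻¹' F)).snd = (ν.restrict (Prod.fst ⁻¹' F)).snd :=
    ext_of_forall_integral_eq_of_IsFiniteMeasure fun g => by
      rw [integral_snd, integral_snd, h F hF g]
  rw [← snd_apply, ← snd_apply, snd_eq]

end WeakLimits

section OrbitAverages

variable {α : Type*} [MeasurableSpace α] {S : α → α} {ν : Measure α}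

/-- The average of the first `n` push-forwards of `ν` along `S`; it is the zero measure for
`n = 0`. -/
def averageMeasure (S : α → α) (ν : Measure α) (n : ℕ) : Measure α :=
  (n : ENNReal)⁻¹ • ∑ i ∈ Finset.range n, ν.map S^[i]

lemma averageMeasure_map_eq {β : Type*} [MeasurableSpace β] {ϑ : β → β} {π : α → β}
    (hπ : Measurable π) (hS : Measurable S) (hsemi : Function.Semiconj π S ϑ)
    (hϑ : MeasurePreserving ϑ (ν.map π) (ν.map π)) {n : ℕ} (hn : n ≠ 0) :
    (averageMeasure S ν n).map π = ν.map π := by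
  have map_iterate i : (ν.map S^[i]).map π = ν.map π := by
    rw [Measure.map_map hπ (hS.iterate i), (hsemi.iterate_right i).comp_eq,
      ← Measure.map_map (hϑ.measurable.iterate i) hπ, (hϑ.iterate i).map_eq]
  rw [averageMeasure, Measure.map_smul, Measure.map_finset_sum hπ.aemeasurable]
  simp only [map_iterate, Finset.sum_const, Finset.card_range, ← Nat.cast_smul_eq_nsmul ENNReal,
    smul_smul, ENNReal.inv_mul_cancel (Nat.cast_ne_zero.2 hn) (ENNReal.natCast_ne_top n), one_smul]

lemma ae_averageMeasure_mem {A : Set α} (hS : Measurable S) (hA : MeasurableSet A)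
    (hSA : Set.MapsTo S A A) (hν : ∀ᵐ p ∂ν, p ∈ A) (n : ℕ) : ∀ᵐ p ∂averageMeasure S ν n, p ∈ A := by
  refine Measure.ae_smul_measure ?_ _
  refine ae_finsetSum_measure_iff.2 fun i _ => (ae_map_iff (hS.iterate i).aemeasurable hA).2 ?_
  filter_upwards [hν] with p hp
  exact hSA.iterate i hp

lemma integral_averageMeasure [IsFiniteMeasure ν] (hS : Measurable S) (n : ℕ) {h : α → ℝ}
    (hh : Measurable h) {c : ℝ} (hc : ∀ p, |h p| ≤ c) :
    ∫ p, h p ∂averageMeasure S ν n = (∫ p, birkhoffSum S h n p ∂ν) / n := by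
  rw [averageMeasure, integral_smul_measure, integral_finsetSum_measure fun i _ =>
    .of_bound hh.aestronglyMeasurable c (.of_forall hc)]
  simp only [integral_map (hS.iterate _).aemeasurable hh.aestronglyMeasurable, birkhoffSum]
  have integrable_comp i : Integrable (fun p => h (S^[i] p)) ν :=
    .of_bound (hh.comp (hS.iterate i)).aestronglyMeasurable c (.of_forall fun p => hc _)
  rw [integral_finsetSum _ fun i _ => integrable_comp i, div_eq_inv_mul, ENNReal.toReal_inv,
    ENNReal.toReal_natCast, smul_eq_mul]

/-- The measures that a map moves by at most `ε`, in the sense of integrals of measurable functions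
with values in `[-1, 1]`. -/
def nearlyInvariant (S : α → α) (ε : ℝ) : Set (Measure α) :=
  {μ | ∀ h : α → ℝ, Measurable h → (∀ p, |h p| ≤ 1) → |∫ p, h (S p) ∂μ - ∫ p, h p ∂μ| ≤ ε}

lemma monotone_nearlyInvariant : Monotone (nearlyInvariant S) :=
  fun _ _ hε _ hμ h hh hh1 => (hμ h hh hh1).trans hε

lemma abs_integral_comp_sub_le {ε : ℝ} {μ : Measure α} (hμ : μ ∈ nearlyInvariant S ε) {h : α → ℝ}
    (hh : Measurable h) {c : ℝ} (hc : 0 < c) (hhc : ∀ p, |h p| ≤ c) :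
    |∫ p, h (S p) ∂μ - ∫ p, h p ∂μ| ≤ ε * c := by
  have scaled := hμ (fun p => h p / c) (hh.div_const c) fun p => by
    rw [abs_div, abs_of_pos hc]
    exact (div_le_one hc).2 (hhc p)
  rwa [integral_div, integral_div, ← sub_div, abs_div, abs_of_pos hc, div_le_iff₀ hc] at scaled

lemma integral_midpoint_measure {μ ξ : Measure α} {h : α → ℝ} (hμ : Integrable h μ)
    (hξ : Integrable h ξ) :
    ∫ p, h p ∂((2⁻¹ : ENNReal) • (μ + ξ)) = (∫ p, h p ∂μ + ∫ p, h p ∂ξ) / 2 := by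
  rw [integral_smul_measure, integral_add_measure hμ hξ, div_eq_inv_mul]
  simp

lemma midpoint_mem_nearlyInvariant (hS : Measurable S) {ε : ℝ} {μ ξ : Measure α} [IsFiniteMeasure μ]
    [IsFiniteMeasure ξ] (hμ : μ ∈ nearlyInvariant S ε) (hξ : ξ ∈ nearlyInvariant S ε) :
    (2⁻¹ : ENNReal) • (μ + ξ) ∈ nearlyInvariant S ε := by
  intro h hh hh1
  have integrable (ζ : Measure α) [IsFiniteMeasure ζ] : Integrable h ζ :=
    .of_bound hh.aestronglyMeasurable 1 (.of_forall hh1)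
  have integrable_comp (ζ : Measure α) [IsFiniteMeasure ζ] : Integrable (fun p => h (S p)) ζ :=
    .of_bound (hh.comp hS).aestronglyMeasurable 1 (.of_forall fun p => hh1 _)
  rw [integral_midpoint_measure (integrable μ) (integrable ξ),
    integral_midpoint_measure (integrable_comp μ) (integrable_comp ξ)]
  have hμh := abs_le.1 (hμ h hh hh1)
  have hξh := abs_le.1 (hξ h hh hh1)
  exact abs_le.2 ⟨by linarith, by linarith⟩

lemma averageMeasure_mem_nearlyInvariant [IsProbabilityMeasure ν] (hS : Measurable S) (n : ℕ) :
    averageMeasure S ν n ∈ nearlyInvariant S (2 / n) := by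
  intro h hh hh1
  have integrable (g : α → ℝ) (hg : Measurable g) (hg1 : ∀ p, |g p| ≤ 1) :
      Integrable (birkhoffSum S g n) ν :=
    .of_bound (measurable_birkhoffSum hS hg n).aestronglyMeasurable (n * 1)
      (.of_forall (abs_birkhoffSum_le hg1 n))
  have telescope p : birkhoffSum S (fun p => h (S p)) n p - birkhoffSum S h n p =
      h (S^[n] p) - h p := by
    rw [← birkhoffSum_apply_sub_birkhoffSum]
    simp only [birkhoffSum, ← Function.iterate_succ_apply, Function.iterate_succ_apply']
  have norm_sub_le_two p : ‖h (S^[n] p) - h p‖ ≤ 2 :=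
    (norm_sub_le _ _).trans ((add_le_add (hh1 _) (hh1 _)).trans_eq one_add_one_eq_two)
  rw [integral_averageMeasure (h := fun p => h (S p)) hS n (hh.comp hS) fun p => hh1 _,
    integral_averageMeasure hS n hh hh1, ← sub_div, abs_div, Nat.abs_cast,
    ← integral_sub (integrable (fun p => h (S p)) (hh.comp hS) fun p => hh1 _)
      (integrable h hh hh1)]
  simp only [telescope]
  gcongr
  simpa using norm_integral_le_of_norm_le_const (μ := ν) (.of_forall norm_sub_le_two)

end OrbitAverages

lemma abs_indicator_one_le {α : Type*} (s : Set α) (a : α) :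
    |s.indicator (1 : α → ℝ) a| ≤ 1 := by
  simpa using norm_indicator_le_norm_self (s := s) (1 : α → ℝ) a

section BundleMaps

variable {Ω X : Type*} {ϑ : Ω → Ω} {A : Set (Ω × X)} {S : Ω × X → Ω × X} {f : Ω × X → ℝ}

lemma bddAbove_image_birkhoffSum {C : ℝ} (hC : ∀ p, |f p| ≤ C) (n : ℕ) (ω : Ω) :
    BddAbove ((fun x => birkhoffSum S f n (ω, x)) '' (Prod.mk ω ⁻¹' A)) :=
  ⟨n * C, Set.forall_mem_image.2 fun _ _ => le_of_abs_le (abs_birkhoffSum_le hC n _)⟩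

variable [MeasurableSpace Ω] [MeasurableSpace X] [TopologicalSpace X]

/-- `S` is a measurable skew product over `ϑ` that maps the random compact set `A` into itself. It
acts on the whole product space, so that its iterates and push-forwards need no subtypes. -/
structure IsBundleMap (ϑ : Ω → Ω) (A : Set (Ω × X)) (S : Ω × X → Ω × X) : Prop where
  isRandomCompact : IsRandomCompact A
  measurable : Measurable S
  semiconj : Function.Semiconj Prod.fst S ϑ
  mapsTo : Set.MapsTo S A A

/-- The probability measures with marginal `P` that are concentrated on `A` and invariant under
`S`. -/
def bundleInvariantMeasures (P : Measure Ω) (A : Set (Ω × X)) (S : Ω × X → Ω × X) :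
    Set (Measure (Ω × X)) :=
  {μ | IsProbabilityMeasure μ ∧ μ.fst = P ∧ (∀ᵐ p ∂μ, p ∈ A) ∧ MeasurePreserving S μ μ}

namespace IsBundleMap

variable {P : Measure Ω} (hS : IsBundleMap ϑ A S)

include hS

lemma iterate_eq (i : ℕ) (ω : Ω) (x : X) : S^[i] (ω, x) = (ϑ^[i] ω, (S^[i] (ω, x)).2) :=
  Prod.ext (hS.semiconj.iterate_right i (ω, x)) rfl

lemma mapsTo_iterate_fiber (i : ℕ) (ω : Ω) :
    Set.MapsTo (fun x => (S^[i] (ω, x)).2) (Prod.mk ω ⁻¹' A) (Prod.mk (ϑ^[i] ω) ⁻¹' A) :=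
  fun x hx => by
    rw [Set.mem_preimage, ← hS.iterate_eq]
    exact hS.mapsTo.iterate i hx

lemma ae_continuousOn_iterate (hϑ : MeasurePreserving ϑ P P)
    (hcont : ∀ᵐ ω ∂P, ContinuousOn (fun x => (S (ω, x)).2) (Prod.mk ω ⁻¹' A)) :
    ∀ᵐ ω ∂P, ∀ i, ContinuousOn (fun x => (S^[i] (ω, x)).2) (Prod.mk ω ⁻¹' A) := by
  filter_upwards [ae_all_iff.2 fun i => (hϑ.iterate i).quasiMeasurePreserving.ae hcont]
    with ω hω i
  induction i with
  | zero => exact continuousOn_id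
  | succ i ih =>
    refine ((hω i).comp ih (hS.mapsTo_iterate_fiber i ω)).congr fun x _ => ?_
    rw [Function.iterate_succ_apply', hS.iterate_eq]
    rfl

lemma ae_upperSemicontinuousOn_birkhoffSum (hϑ : MeasurePreserving ϑ P P)
    (hcont : ∀ᵐ ω ∂P, ContinuousOn (fun x => (S (ω, x)).2) (Prod.mk ω ⁻¹' A))
    (husc : ∀ᵐ ω ∂P, UpperSemicontinuousOn (fun x => f (ω, x)) (Prod.mk ω ⁻¹' A)) (n : ℕ) :
    ∀ᵐ ω ∂P, UpperSemicontinuousOn (fun x => birkhoffSum S f n (ω, x)) (Prod.mk ω ⁻¹' A) := by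
  filter_upwards [hS.ae_continuousOn_iterate hϑ hcont,
    ae_all_iff.2 fun i => (hϑ.iterate i).quasiMeasurePreserving.ae husc] with ω hcontω huscω
  refine upperSemicontinuousOn_sum fun i _ => ?_
  simpa only [Function.comp_def, ← hS.iterate_eq] using
    (huscω i).comp (hcontω i) (hS.mapsTo_iterate_fiber i ω)

lemma subadditiveProcess_fiberSup [StandardBorelSpace X] (P : Measure Ω) [IsFiniteMeasure P]
    [P.IsComplete] (hf : Measurable f) {C : ℝ} (hC : ∀ p, |f p| ≤ C) :
    SubadditiveProcess ϑ (fun n => fiberSup A (birkhoffSum S f n)) C where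
  measurable n := measurable_fiberSup P hS.isRandomCompact.measurableSet
    hS.isRandomCompact.nonempty_fiber (measurable_birkhoffSum hS.measurable hf n)
    (bddAbove_image_birkhoffSum hC n)
  abs_le_mul n ω := by
    have ⟨x, hx⟩ := hS.isRandomCompact.nonempty_fiber ω
    have := (hS.isRandomCompact.nonempty_fiber ω).to_subtype
    have bounds y := abs_le.1 (abs_birkhoffSum_le (τ := S) hC n (ω, y))
    exact abs_le.2 ⟨(bounds x).1.trans (le_fiberSup (bddAbove_image_birkhoffSum hC n ω) hx),
      ciSup_le fun y => (bounds y).2⟩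
  add_le m n ω := by
    have := (hS.isRandomCompact.nonempty_fiber ω).to_subtype
    refine ciSup_le fun x => ?_
    rw [birkhoffSum_add, hS.iterate_eq]
    exact add_le_add (le_fiberSup (bddAbove_image_birkhoffSum hC m ω) x.2)
      (le_fiberSup (bddAbove_image_birkhoffSum hC n _) (hS.mapsTo_iterate_fiber m ω x.2))

lemma mul_integral_le_integral_fiberSup [StandardBorelSpace X] [IsFiniteMeasure P] [P.IsComplete]
    (hf : Measurable f) {C : ℝ} (hC : ∀ p, |f p| ≤ C) {μ : Measure (Ω × X)}
    (hμ : μ ∈ bundleInvariantMeasures P A S) (n : ℕ) :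
    n * ∫ p, f p ∂μ ≤ ∫ ω, fiberSup A (birkhoffSum S f n) ω ∂P := by
  obtain ⟨hprob, hfst, hmem, hinv⟩ := hμ
  have fst_preserving : MeasurePreserving Prod.fst μ P := ⟨measurable_fst, hfst⟩
  have integrable_f : Integrable f μ := .of_bound hf.aestronglyMeasurable C (.of_forall hC)
  have integrable_sup : Integrable (fiberSup A (birkhoffSum S f n)) P :=
    (hS.subadditiveProcess_fiberSup P hf hC).integrable P n
  rw [← integral_birkhoffSum hinv integrable_f,
    ← integral_comp_of_measurePreserving fst_preserving integrable_sup.aestronglyMeasurable]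
  refine integral_mono_ae (integrable_birkhoffSum hinv integrable_f n)
    (fst_preserving.integrable_comp_of_integrable integrable_sup) ?_
  filter_upwards [hmem] with p hp
  exact le_fiberSup (bddAbove_image_birkhoffSum hC n p.1) hp

end IsBundleMap

end BundleMaps

section VariationalPrinciple

open ProbabilityTheory BoundedContinuousFunction

variable {Ω X : Type*} [MeasurableSpace Ω] {P : Measure Ω} {ϑ : Ω → Ω}
  [MeasurableSpace X] {A D : Set (Ω × X)} {S : Ω × X → Ω × X}

/-- The measures over `P` that are concentrated on `A`, are `ε`-nearly invariant under `S` and give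
`D` mass at least `a - ε`. -/
def nearlyOptimalMeasures (P : Measure Ω) (A : Set (Ω × X)) (S : Ω × X → Ω × X) (D : Set (Ω × X))
    (a ε : ℝ) : Set (Measure (Ω × X)) :=
  {μ ∈ nearlyInvariant S ε | μ.fst = P ∧ (∀ᵐ p ∂μ, p ∈ A) ∧ a - ε ≤ μ.real D}

lemma monotone_nearlyOptimalMeasures (a : ℝ) : Monotone (nearlyOptimalMeasures P A S D a) :=
  fun _ _ hε _ ⟨hinv, hfst, hmem, hD⟩ =>
    ⟨monotone_nearlyInvariant hε hinv, hfst, hmem, (sub_le_sub_left hε a).trans hD⟩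

variable [IsProbabilityMeasure P]

lemma midpoint_mem_nearlyOptimalMeasures (hS : Measurable S) {a ε : ℝ} {μ ξ : Measure (Ω × X)}
    (hμ : μ ∈ nearlyOptimalMeasures P A S D a ε) (hξ : ξ ∈ nearlyOptimalMeasures P A S D a ε) :
    (2⁻¹ : ENNReal) • (μ + ξ) ∈ nearlyOptimalMeasures P A S D a ε := by
  obtain ⟨hμinv, hμfst, hμmem, hμD⟩ := hμ
  obtain ⟨hξinv, hξfst, hξmem, hξD⟩ := hξ
  have := isProbabilityMeasure_of_fst_eq hμfst
  have := isProbabilityMeasure_of_fst_eq hξfst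
  refine ⟨midpoint_mem_nearlyInvariant hS hμinv hξinv, ?_,
    Measure.ae_smul_measure (ae_add_measure_iff.2 ⟨hμmem, hξmem⟩) _, ?_⟩
  · rw [Measure.fst, Measure.map_smul, Measure.map_add _ _ measurable_fst, ← Measure.fst,
      ← Measure.fst, hμfst, hξfst, ← two_smul ENNReal P, smul_smul,
      ENNReal.inv_mul_cancel two_ne_zero ENNReal.ofNat_ne_top, one_smul]
  · rw [measureReal_ennreal_smul_apply, measureReal_add_apply, ENNReal.toReal_inv,
      ENNReal.toReal_ofNat]
    linarith

variable [MetricSpace X] [CompactSpace X] [BorelSpace X]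

namespace IsBundleMap

section Limit

variable {κ : ℕ → Kernel Ω X} {η : Kernel Ω X} [∀ n, IsMarkovKernel (κ n)] [IsMarkovKernel η]
  (hS : IsBundleMap ϑ A S)

include hS

lemma measurePreserving_compProd
    (hcont : ∀ᵐ ω ∂P, ContinuousOn (fun x => (S (ω, x)).2) (Prod.mk ω ⁻¹' A))
    (h : AETendstoWeakly P κ η) (hκ : ∀ n, ∀ᵐ p ∂P.compProd (κ n), p ∈ A) {ε : ℕ → ℝ}
    (hε : Tendsto ε atTop (𝓝 0)) (hinv : ∀ n, P.compProd (κ n) ∈ nearlyInvariant S (ε n)) :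
    MeasurePreserving S (P.compProd η) (P.compProd η) := by
  have := Measure.isProbabilityMeasure_map (μ := P.compProd η) hS.measurable.aemeasurable
  refine ⟨hS.measurable, ext_of_forall_integral_indicator_mul fun F hF g => ?_⟩
  let f (p : Ω × X) : ℝ := F.indicator 1 p.1 * g p.2
  have measurable_f : Measurable f := ((measurable_one.indicator hF).comp measurable_fst).mul
    (g.continuous.measurable.comp measurable_snd)
  have abs_f_le p : |f p| ≤ ‖g‖ + 1 := by
    calc |F.indicator 1 p.1 * g p.2| = |F.indicator (1 : Ω → ℝ) p.1| * |g p.2| := abs_mul _ _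
      _ ≤ 1 * ‖g‖ := mul_le_mul (abs_indicator_one_le F _) (g.norm_coe_le_norm _) (abs_nonneg _)
        zero_le_one
      _ ≤ ‖g‖ + 1 := by linarith
  have tendsto_f := h.tendsto_integral_compProd hS.isRandomCompact.isClosed_fiber hκ measurable_f
    abs_f_le <| .of_forall fun ω => (continuous_const (y := F.indicator 1 ω)).continuousOn.mul
      g.continuous.continuousOn
  have tendsto_f_comp := h.tendsto_integral_compProd hS.isRandomCompact.isClosed_fiber hκ
    (measurable_f.comp hS.measurable) (fun p => abs_f_le (S p)) <| by
      filter_upwards [hcont] with ω hω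
      simp only [Function.comp_def, f, hS.semiconj _]
      exact continuousOn_const.fun_mul (g.continuous.comp_continuousOn hω)
  have difference_tendsto_zero : Tendsto
      (fun n => ∫ p, f (S p) ∂P.compProd (κ n) - ∫ p, f p ∂P.compProd (κ n)) atTop (𝓝 0) :=
    squeeze_zero_norm
      (fun n => abs_integral_comp_sub_le (hinv n) measurable_f (by positivity) abs_f_le)
      (by simpa using hε.mul_const (‖g‖ + 1))
  rw [integral_map hS.measurable.aemeasurable measurable_f.aestronglyMeasurable]
  exact sub_eq_zero.1
    (tendsto_nhds_unique (tendsto_f_comp.sub tendsto_f) difference_tendsto_zero)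

end Limit

theorem exists_mem_bundleInvariantMeasures_le (hS : IsBundleMap ϑ A S)
    (hcont : ∀ᵐ ω ∂P, ContinuousOn (fun x => (S (ω, x)).2) (Prod.mk ω ⁻¹' A))
    (hD : MeasurableSet D) (hclosed : ∀ ω, IsClosed (Prod.mk ω ⁻¹' D)) {a : ℝ}
    (h : ∀ ε > 0, (nearlyOptimalMeasures P A S D a ε).Nonempty) :
    ∃ μ ∈ bundleInvariantMeasures P A S, a ≤ μ.real D := by
  let ε : ℕ → ℝ := fun n => 1 / ((n : ℝ) + 1)
  have tendsto_ε : Tendsto ε atTop (𝓝 0) := tendsto_one_div_add_atTop_nhds_zero_nat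
  have antitone_ε : Antitone ε := fun n m hnm => Nat.one_div_le_one_div hnm
  obtain ⟨κ, η, hκ, hκM, hη, hlim⟩ := exists_aetendstoWeakly_compProd_mem
    (M := fun n => nearlyOptimalMeasures P A S D a (ε n))
    ((monotone_nearlyOptimalMeasures a).comp_antitone antitone_ε)
    (fun n => h _ Nat.one_div_pos_of_nat) (fun n μ hμ => hμ.2.1)
    (fun n μ hμ ξ hξ => midpoint_mem_nearlyOptimalMeasures hS.measurable hμ hξ)
  have hκA n := (hκM n).2.2.1
  refine ⟨P.compProd η, ⟨inferInstance, Measure.fst_compProd P η,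
    hlim.ae_compProd_mem hS.isRandomCompact.measurableSet hS.isRandomCompact.isClosed_fiber hκA,
    hS.measurePreserving_compProd hcont hlim hκA tendsto_ε fun n => (hκM n).1⟩, ?_⟩
  refine (ENNReal.ofReal_le_iff_le_toReal (measure_ne_top _ _)).1 ?_
  calc ENNReal.ofReal a = limsup (fun n => ENNReal.ofReal (a - ε n)) atTop := by
        have := ENNReal.tendsto_ofReal (tendsto_ε.const_sub a)
        rw [this.limsup_eq, sub_zero]
    _ ≤ limsup (fun n => P.compProd (κ n) D) atTop := limsup_le_limsup <| .of_forall fun n =>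
        ENNReal.ofReal_le_of_le_toReal (hκM n).2.2.2
    _ ≤ P.compProd η D := hlim.limsup_compProd_le hD hclosed

section Maximization

variable [P.IsComplete] (hS : IsBundleMap ϑ A S) (hϑ : MeasurePreserving ϑ P P)
  (hcont : ∀ᵐ ω ∂P, ContinuousOn (fun x => (S (ω, x)).2) (Prod.mk ω ⁻¹' A))

include hS hϑ hcont

lemma exists_mem_nearlyInvariant_integral_eq {f : Ω × X → ℝ} (hf : Measurable f) {C : ℝ}
    (hC : ∀ p, |f p| ≤ C)
    (husc : ∀ᵐ ω ∂P, UpperSemicontinuousOn (fun x => f (ω, x)) (Prod.mk ω ⁻¹' A)) {n : ℕ}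
    (hn : n ≠ 0) :
    ∃ μ ∈ nearlyInvariant S (2 / n), μ.fst = P ∧ (∀ᵐ p ∂μ, p ∈ A) ∧
      ∫ p, f p ∂μ = (∫ ω, fiberSup A (birkhoffSum S f n) ω ∂P) / n := by
  have measurable_sum := measurable_birkhoffSum hS.measurable hf n
  obtain ⟨s, hs, hsA, hmax⟩ := exists_measurable_fiberSup_eq P hS.isRandomCompact measurable_sum
    (hS.ae_upperSemicontinuousOn_birkhoffSum hϑ hcont husc n)
  have hgraph : Measurable fun ω => (ω, s ω) := measurable_id.prodMk hs
  let ν := P.map fun ω => (ω, s ω)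
  have : IsProbabilityMeasure ν := Measure.isProbabilityMeasure_map hgraph.aemeasurable
  have fst_ν : ν.map Prod.fst = P := by
    rw [Measure.map_map measurable_fst hgraph]
    exact Measure.map_id
  refine ⟨averageMeasure S ν n, averageMeasure_mem_nearlyInvariant hS.measurable n, ?_,
    ae_averageMeasure_mem hS.measurable hS.isRandomCompact.measurableSet hS.mapsTo ?_ n, ?_⟩
  · rw [Measure.fst, averageMeasure_map_eq measurable_fst hS.measurable hS.semiconj
      (fst_ν.symm ▸ hϑ) hn, fst_ν]
  · exact (ae_map_iff hgraph.aemeasurable hS.isRandomCompact.measurableSet).2 (.of_forall hsA)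
  · rw [integral_averageMeasure hS.measurable n hf hC,
      integral_map hgraph.aemeasurable measurable_sum.aestronglyMeasurable, integral_congr_ae hmax]

theorem isLUB_integral_lowerRate (hD : MeasurableSet D)
    (hclosed : ∀ ω, IsClosed (Prod.mk ω ⁻¹' D)) :
    IsLUB ((fun μ => μ.real D) '' bundleInvariantMeasures P A S)
      (∫ ω, lowerRate (fun n => fiberSup A (birkhoffSum S (D.indicator 1) n)) ω ∂P) := by
  have measurable_f : Measurable (D.indicator (1 : Ω × X → ℝ)) := measurable_one.indicator hD
  have abs_f_le := abs_indicator_one_le D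
  have husc ω : UpperSemicontinuousOn (fun x => D.indicator (1 : Ω × X → ℝ) (ω, x))
      (Prod.mk ω ⁻¹' A) :=
    (hclosed ω).upperSemicontinuousOn_indicator zero_le_one
  have hlim := (hS.subadditiveProcess_fiberSup P measurable_f abs_f_le).tendsto_integral_div hϑ
  refine isLUB_iff_le_iff.2 fun c => ⟨fun hc => ?_, fun hc => ?_⟩
  · rintro _ ⟨μ, hμ, rfl⟩
    refine (ge_of_tendsto hlim ?_).trans hc
    filter_upwards [eventually_gt_atTop 0] with n hn
    rw [le_div_iff₀' (Nat.cast_pos.2 hn), ← integral_indicator_one hD]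
    exact hS.mul_integral_le_integral_fiberSup measurable_f abs_f_le hμ n
  · obtain ⟨μ, hμ, hle⟩ := hS.exists_mem_bundleInvariantMeasures_le hcont hD hclosed fun ε hε => by
      have eventually_two_div_lt : ∀ᶠ n : ℕ in atTop, 2 / (n : ℝ) < ε :=
        (tendsto_const_div_atTop_nhds_zero_nat 2).eventually_lt_const hε
      obtain ⟨n, near_limit, two_div_lt, hn⟩ := ((hlim.eventually_const_lt (sub_lt_self _ hε)).and
        (eventually_two_div_lt.and (eventually_ne_atTop 0))).exists
      obtain ⟨μ, hinv, hfst, hmem, integral_eq⟩ := hS.exists_mem_nearlyInvariant_integral_eq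
        hϑ hcont measurable_f abs_f_le (.of_forall husc) hn
      refine ⟨μ, monotone_nearlyInvariant two_div_lt.le hinv, hfst, hmem, ?_⟩
      rw [← integral_indicator_one hD, integral_eq]
      exact near_limit.le
    exact hle.trans (hc ⟨μ, hμ, rfl⟩)

end Maximization

end IsBundleMap

end VariationalPrinciple

namespace BundleRDS

variable {Ω : Type*} [MeasurableSpace Ω] {P : Measure Ω} {ϑ : Ω → Ω}
  {X : Type*} [TopologicalSpace X] [MeasurableSpace X]

open Classical in
/-- The skew product extended to the whole product space. Off the bundle it does not move the second
coordinate; this choice is irrelevant, because every measure considered is carried by the bundle. -/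
def extendedSkew (R : BundleRDS P ϑ X) (p : Ω × X) : Ω × X :=
  (ϑ p.1, if h : p ∈ R.carrier then R.T p.1 ⟨p.2, h⟩ else p.2)

variable (R : BundleRDS P ϑ X)

lemma semiconj_coe_skew : Function.Semiconj Subtype.val R.skew R.extendedSkew :=
  fun p => Eq.symm (Prod.ext rfl (dif_pos p.2))

lemma isBundleMap_extendedSkew (hϑ : Measurable ϑ) :
    IsBundleMap ϑ R.carrier R.extendedSkew where
  isRandomCompact := ⟨R.measurableSet_carrier, R.nonempty_fiber, R.isCompact_fiber⟩
  measurable := by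
    classical
    exact (hϑ.comp measurable_fst).prodMk <| Measurable.dite (s := R.carrier)
      (f := fun p : R.carrier => (R.T p.1.1 ⟨p.1.2, p.2⟩ : X))
      (g := fun p : (R.carrierᶜ : Set (Ω × X)) => p.1.2) R.measurable_T
      (measurable_snd.comp measurable_subtype_coe) R.measurableSet_carrier
  semiconj := fun _ => rfl
  mapsTo p hp := R.semiconj_coe_skew ⟨p, hp⟩ ▸ (R.skew ⟨p, hp⟩).2

lemma ae_continuousOn_extendedSkew :
    ∀ᵐ ω ∂P, ContinuousOn (fun x => (R.extendedSkew (ω, x)).2) (Prod.mk ω ⁻¹' R.carrier) := by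
  filter_upwards [R.continuous_T] with ω hω
  rw [continuousOn_iff_continuous_domRestrict]
  exact (continuous_subtype_val.comp hω).congr fun x =>
    congrArg Prod.snd (R.semiconj_coe_skew ⟨(ω, x), x.2⟩)

lemma iter_eq_skew_iterate (i : ℕ) (ω : Ω) (x : R.fiber ω) :
    (R.iter i ω x : X) = (R.skew^[i] ⟨(ω, x), x.2⟩).1.2 := by
  induction i generalizing ω with
  | zero => rfl
  | succ _ ih => exact ih (ϑ ω) (R.T ω x)

lemma orbitFreq_eq_fiberSup_div (E : Set X) (n : ℕ) (ω : Ω) :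
    R.orbitFreq E n ω = fiberSup R.carrier
      (birkhoffSum R.extendedSkew ((Set.univ ×ˢ E).indicator 1) n) ω / n := by
  rw [orbitFreq, one_div_mul_eq_div]
  congr 1
  refine iSup_congr fun x => Finset.sum_congr rfl fun i _ => ?_
  rw [iter_eq_skew_iterate, R.semiconj_coe_skew.iterate_right i ⟨(ω, x), x.2⟩]
  rw [Set.univ_prod]
  rfl

lemma comap_map_coe {μ : Measure (Ω × X)} (hμ : ∀ᵐ p ∂μ, p ∈ R.carrier) :
    (μ.comap (Subtype.val : R.carrier → Ω × X)).map Subtype.val = μ := by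
  rw [(MeasurableEmbedding.subtype_coe R.measurableSet_carrier).map_comap, Subtype.range_coe]
  exact Measure.restrict_eq_self_of_ae_mem hμ

lemma measurable_skew (hϑ : Measurable ϑ) : Measurable R.skew :=
  ((hϑ.comp (measurable_fst.comp measurable_subtype_coe)).prodMk R.measurable_T).subtype_mk

lemma measurePreserving_skew_iff (hϑ : Measurable ϑ) {μ : Measure (Ω × X)}
    (hμ : ∀ᵐ p ∂μ, p ∈ R.carrier) :
    MeasurePreserving R.skew (μ.comap (Subtype.val : R.carrier → Ω × X))
      (μ.comap (Subtype.val : R.carrier → Ω × X)) ↔ MeasurePreserving R.extendedSkew μ μ := by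
  have measurableEmbedding_coe := MeasurableEmbedding.subtype_coe R.measurableSet_carrier
  have measurable_extendedSkew := (R.isBundleMap_extendedSkew hϑ).measurable
  have map_extendedSkew : μ.map R.extendedSkew =
      ((μ.comap (Subtype.val : R.carrier → Ω × X)).map R.skew).map Subtype.val := by
    rw [Measure.map_map measurable_subtype_coe (R.measurable_skew hϑ),
      R.semiconj_coe_skew.comp_eq,
      ← Measure.map_map measurable_extendedSkew measurable_subtype_coe, R.comap_map_coe hμ]
  refine ⟨fun h => ⟨measurable_extendedSkew, ?_⟩, fun h => ⟨R.measurable_skew hϑ, ?_⟩⟩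
  · rw [map_extendedSkew, h.map_eq, R.comap_map_coe hμ]
  · rw [← measurableEmbedding_coe.comap_map (Measure.map R.skew _), ← map_extendedSkew, h.map_eq]

lemma invariantMeasures_eq (hϑ : Measurable ϑ) :
    R.invariantMeasures = bundleInvariantMeasures P R.carrier R.extendedSkew := by
  ext μ
  refine and_congr_right fun hμ => and_congr_right fun _ => ?_
  have ae_mem_iff : (∀ᵐ p ∂μ, p ∈ R.carrier) ↔ μ R.carrier = 1 :=
    prob_compl_eq_zero_iff R.measurableSet_carrier
  rw [← ae_mem_iff]
  exact and_congr_right fun hmem => R.measurePreserving_skew_iff hϑ hmem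

end BundleRDS

theorem mainTheorem5 {Ω : Type*} [MeasurableSpace Ω] (P : Measure Ω) [IsProbabilityMeasure P]
    [P.IsComplete] (ϑ : Ω → Ω) (hϑ : MeasurePreserving ϑ P P)
    {X : Type*} [MetricSpace X] [CompactSpace X] [MeasurableSpace X] [BorelSpace X]
    (R : BundleRDS P ϑ X) (E : Set X) (hE : IsClosed E) :
    (∀ᵐ ω ∂P, Tendsto (fun n : ℕ => R.orbitFreq E n ω) atTop (𝓝 (R.ocap E ω))) ∧
    Integrable (R.ocap E) P ∧
    IsLUB ((fun μ : Measure (Ω × X) => μ.real (Set.univ ×ˢ E)) '' R.invariantMeasures)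
      (∫ ω, R.ocap E ω ∂P) := by
  have bundleMap := R.isBundleMap_extendedSkew hϑ.measurable
  have measurableSet_univ_prod : MeasurableSet ((Set.univ : Set Ω) ×ˢ E) :=
    MeasurableSet.univ.prod hE.measurableSet
  have process := bundleMap.subadditiveProcess_fiberSup P
    (measurable_one.indicator measurableSet_univ_prod) (abs_indicator_one_le _)
  have tendsto_orbitFreq := process.ae_tendsto_div hϑ
  simp only [← R.orbitFreq_eq_fiberSup_div] at tendsto_orbitFreq
  have ocap_ae_eq : R.ocap E =ᵐ[P] lowerRate
      fun n => fiberSup R.carrier (birkhoffSum R.extendedSkew ((Set.univ ×ˢ E).indicator 1) n) :=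
    tendsto_orbitFreq.mono fun ω hω => hω.limUnder_eq
  refine ⟨?_, (process.integrable_lowerRate P).congr ocap_ae_eq.symm, ?_⟩
  · filter_upwards [tendsto_orbitFreq, ocap_ae_eq] with ω htendsto hocap
    rwa [hocap]
  · rw [integral_congr_ae ocap_ae_eq, R.invariantMeasures_eq hϑ.measurable]
    exact bundleMap.isLUB_integral_lowerRate hϑ R.ae_continuousOn_extendedSkew
      measurableSet_univ_prod fun ω => by simpa using hE

end
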